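/- Let $d\ge 1$ and identify a polynomial $f(x)=\sum_{i=0}^d f_i x^i$ with its coefficient vector in $\mathbb C^{d+1}$. Let $\|f\|^2=\sum_i |f_i|^2/\binom di$ be Weyl's unitarily invariant norm. The Kostlan distribution is the law under which the $f_i$ are independent centred circular complex Gaussians with $E|f_i|^2=\binom di$; the class $[f]$ is then uniformly distributed in the projective space of polynomials (with the Fubini-Study volume of $\|\cdot\|$, normalized to total mass $1$). Renormalized Graeffe iteration. A complex number $w\neq0$ is represented at level $k$ by $(2^{-k}\log|w|,\arg w)\in\mathbb R\times\mathbb R/2\pi\mathbb Z$; start at level $0$ from the coefficients of $f$, and let step $k\to k+1$ compute, in these coordinates, the Graeffe iterate $$h_i=(-1)^{d+i}f_i^2+2\sum_{1\le j\le\min(i,d-i)}(-1)^{d+i-j}f_{i-j}f_{i+j},\qquad 0\le i\le d,$$ by the renormalized operations: $(x,\alpha)(y,\beta)=(x+y,\alpha+\beta)$; multiplication of $(x,\alpha)$ by a constant $z$ gives $(x+2^{-k}\log|z|,\alpha+\arg z)$; the sum of $(x,\alpha)$ and $(y,\beta)$ is $(2^{-k}\log|s|,\arg s)$ with $s=e^{i\alpha+2^kx}+e^{i\beta+2^ky}$;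 passing from level $k$ to $k+1$ sends $(x,\alpha)$ to $(x/2,\alpha)$. If $r^{(k)}_0,\dots,r^{(k)}_d$ are the magnitudes (first coordinates) after $k$ steps and $|\zeta_1|\ge\dots\ge|\zeta_d|$ are the moduli of the roots of $f$, the approximation of $\log|\zeta_i|$ after $k$ steps is $\lambda^{(k)}_i=r^{(k)}_{d-i}-r^{(k)}_{d-i+1}$. Theorem. There are universal constants $c_2,c_3$ such that the following holds for every $d\ge1$ and every probability distribution $\mu$ of polynomials $f$ for which $f\ne0$ almost surely and the law of $[f]$ is absolutely continuous with bounded Radon-Nikodym derivative with respect to the volume of the projective space (for instance the Kostlan distribution). There is a constant $c_1$, depending on $d$ and $\mu$, such that for all real $b\ge1+\log_2 d$ and $\delta>0$, with probability at least $1-\delta$ the polynomial $f$ has $d$ non-zero roots and, for every integer $k\ge0$ with $k\ge c_1+c_2\log_2 b-c_3\log_2\delta$, $$\bigl|\lambda^{(k)}_i-\log|\zeta_i|\bigr|\le 2^{-b}\,\bigl|\log|\zeta_i|\bigr|\qquad(i=1,\dots,d).$$ -/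

import Mathlib

open MeasureTheory ProbabilityTheory
open scoped NNReal ENNReal LinearAlgebra.Projectivization

noncomputable section

namespace RenormalizedGraeffe

/-! ### Renormalized arithmetic -/

/-- A complex number in scaled polar coordinates: (magnitude, argument) in `ℝ × 𝕋`,
where `𝕋 = ℝ / 2πℤ`. -/
abbrev RenVal : Type := ℝ × Real.Angle

/-- Coordinates with renormalization index `k`: `w ↦ (2⁻ᵏ log |w|, arg w)`. -/
def ofComplex (k : ℕ) (w : ℂ) : RenVal := ((2 ^ k)⁻¹ * Real.log ‖w‖, (w.arg : Real.Angle))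

/-- The complex number `e ^ (i α + 2ᵏ x)` represented by `(x, α)` at renormalization index `k`. -/
def toComplex (k : ℕ) (p : RenVal) : ℂ :=
  (Real.exp (2 ^ k * p.1) : ℂ) * (Real.Angle.toCircle p.2 : ℂ)

/-- Renormalized product. -/
def renMul (p q : RenVal) : RenVal := (p.1 + q.1, p.2 + q.2)

/-- Renormalized `n`-th power. -/
def renPow (p : RenVal) (n : ℕ) : RenVal := (n * p.1, n • p.2)

/-- Renormalized product of `p` by the (non-renormalized) constant `z`. -/
def renScal (k : ℕ) (z : ℂ) (p : RenVal) : RenVal :=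
  (p.1 + (2 ^ k)⁻¹ * Real.log ‖z‖, p.2 + (z.arg : Real.Angle))

/-- Renormalized sum at index `k`. -/
def renAdd (k : ℕ) (p q : RenVal) : RenVal := ofComplex k (toComplex k p + toComplex k q)

/-- Conversion from renormalization index `k` to `k + 1` of a value:
`(2⁻ᵏ log |w|, arg w) ↦ (2⁻ᵏ⁻¹ log |w|, arg w)`. -/
def renorm (p : RenVal) : RenVal := (p.1 / 2, p.2)

/-! ### Renormalized Graeffe iteration -/

variable {d : ℕ}

/-- The sign `(-1) ^ (d + i - j)`, for `j ≤ i`. -/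
def graeffeSign (d i j : ℕ) : ℂ := (-1) ^ (d + i - j)

/-- One step of the renormalized Graeffe iteration, from index `k` to index `k + 1`.
It is the Graeffe formula
`h i = (-1)^(d+i) (f i)^2 + 2 ∑_{1 ≤ j ≤ min i (d-i)} (-1)^(d+i-j) f (i-j) f (i+j)`
in coordinates; the inner sum is absent if `min i (d-i) = 0`. (The position `j : Fin _` in the
list stands for the summation index `j + 1`.) -/
def renStep (k : ℕ) (g : Fin (d + 1) → RenVal) (i : Fin (d + 1)) : RenVal :=
  let f : Fin (d + 1) → RenVal := fun m => renorm (g m)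
  let first : RenVal := renScal (k + 1) (graeffeSign d i 0) (renPow (f i) 2)
  let terms : List RenVal := List.ofFn fun j : Fin (min (i : ℕ) (d - i)) =>
    renScal (k + 1) (graeffeSign d i (j + 1))
      (renMul (f ⟨i - (j + 1), by omega⟩) (f ⟨i + (j + 1), by omega⟩))
  match terms with
  | [] => first
  | t :: ts => renAdd (k + 1) first (renScal (k + 1) 2 (ts.foldl (renAdd (k + 1)) t))

/-- The result of `k` steps of the renormalized Graeffe iteration on the polynomial with
coefficients `f 0, …, f d`. -/
def renGraeffe (f : Fin (d + 1) → ℂ) : ℕ → Fin (d + 1) → RenVal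
  | 0 => fun i => ofComplex 0 (f i)
  | k + 1 => renStep k (renGraeffe f k)

/-- The approximation to `log |ζ i|` after `k` steps, the roots being indexed by `0, …, d - 1` in
order of decreasing modulus: with `r` the vector of magnitudes, it is
`r (d - 1 - i) - r (d - i)`. -/
def logModulusApprox (f : Fin (d + 1) → ℂ) (k : ℕ) (i : Fin d) : ℝ :=
  (renGraeffe f k i.rev.castSucc).1 - (renGraeffe f k i.rev.succ).1

/-- The polynomial `f 0 + f 1 X + ⋯ + f d X ^ d`. -/
def toPoly (f : Fin (d + 1) → ℂ) : Polynomial ℂ :=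
  ∑ i : Fin (d + 1), Polynomial.C (f i) * Polynomial.X ^ (i : ℕ)

/-- The polynomial with coefficients `f` has exactly `d` roots `ζ 0, …, ζ (d - 1)`, counted with
multiplicity and ordered by decreasing modulus, all non-zero, and `k` renormalized Graeffe steps
approximate each `log |ζ i|` with relative precision `2 ^ (-b)`. -/
def ApproximatesLogModuli (f : Fin (d + 1) → ℂ) (k : ℕ) (b : ℝ) : Prop :=
  ∃ ζ : Fin d → ℂ, (toPoly f).roots = Multiset.map ζ Finset.univ.val ∧
    Antitone (fun i => ‖ζ i‖) ∧ (∀ i, ζ i ≠ 0) ∧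
    ∀ i, |logModulusApprox f k i - Real.log ‖ζ i‖| ≤ (2 : ℝ) ^ (-b) * |Real.log ‖ζ i‖|

/-! ### Random polynomials -/

/-- The law of `x + i y`, with `x` and `y` independent centred real Gaussians of variance `v / 2`:
the circular complex Gaussian with `E |z| ^ 2 = v`. -/
def complexGaussian (v : ℝ≥0) : Measure ℂ :=
  ((gaussianReal 0 (v / 2)).prod (gaussianReal 0 (v / 2))).map fun p => (⟨p.1, p.2⟩ : ℂ)

/-- Kostlan's distribution on the space of polynomials of degree at most `d`: the coefficients are
independent centred complex Gaussians, `E |f i| ^ 2 = d.choose i`. It is the normal distribution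
with density proportional to `exp (-‖f‖ ^ 2)`, with `‖f‖ ^ 2 = ∑ i, |f i| ^ 2 / d.choose i` the
unitarily invariant Weyl norm. -/
def kostlan (d : ℕ) : Measure (Fin (d + 1) → ℂ) :=
  Measure.pi fun i : Fin (d + 1) => complexGaussian (d.choose i)

/-- The projectivization of the space of polynomials of degree at most `d`, which are given by
their coefficients. -/
abbrev ProjPoly (d : ℕ) : Type := ℙ ℂ (Fin (d + 1) → ℂ)

/-- The Borel σ-algebra of the projective space, which is the quotient σ-algebra. -/
instance instMeasurableSpaceProjPoly (d : ℕ) : MeasurableSpace (ProjPoly d) :=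
  MeasurableSpace.map (Projectivization.mk' ℂ) Subtype.instMeasurableSpace

/-- The law of the projective class of a polynomial with law `μ`. -/
def projLaw (μ : Measure (Fin (d + 1) → ℂ)) : Measure (ProjPoly d) :=
  (μ.comap (Subtype.val : {v : Fin (d + 1) → ℂ // v ≠ 0} → Fin (d + 1) → ℂ)).map
    (Projectivization.mk' ℂ)

/-- The normalized volume of the projective space of polynomials, for the Fubini-Study metric
given by the Weyl norm: the unitarily invariant probability measure, that is, the law of the class
of a polynomial with the invariant normal distribution. -/
def projVolume (d : ℕ) : Measure (ProjPoly d) := projLaw (kostlan d)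

/-- A distribution of random polynomials such that the class of the polynomial in the projective
space almost surely exists and has a law that is absolutely continuous, with bounded
Radon-Nikodym derivative, with respect to the volume of the projective space. -/
def HasBoundedDensity (μ : Measure (Fin (d + 1) → ℂ)) : Prop :=
  μ {0} = 0 ∧ projLaw μ ≪ projVolume d ∧
    ∃ C : ℝ≥0, ∀ᵐ p ∂(projVolume d), (projLaw μ).rnDeriv (projVolume d) p ≤ C

end RenormalizedGraeffe

end

namespace RenormalizedGraeffe

/-! ### The Graeffe iteration in exact arithmetic -/

section Graeffe

open Finset Polynomial

variable {R S : Type*} [CommRing R] [CommRing S]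

/-- The first `m` terms of the inner sum of the Graeffe formula. -/
def graeffeTail (d : ℕ) (f : ℕ → R) (i m : ℕ) : R :=
  ∑ j ∈ range m, (-1) ^ (d + i - (j + 1)) * (f (i - (j + 1)) * f (i + (j + 1)))

/-- The Graeffe iterate of a sequence of coefficients. -/
def graeffe (d : ℕ) (f : ℕ → R) (i : ℕ) : R :=
  (-1) ^ (d + i) * f i ^ 2 + 2 * graeffeTail d f i (min i (d - i))

lemma graeffeTail_smul (d : ℕ) (c : R) (f : ℕ → R) (i m : ℕ) :
    graeffeTail d (c • f) i m = c ^ 2 * graeffeTail d f i m := by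
  simp only [graeffeTail, mul_sum, Pi.smul_apply, smul_eq_mul]
  exact sum_congr rfl fun j _ => by ring

lemma graeffe_smul (d : ℕ) (c : R) (f : ℕ → R) : graeffe d (c • f) = c ^ 2 • graeffe d f := by
  ext i
  simp only [graeffe, graeffeTail_smul, Pi.smul_apply, smul_eq_mul]
  ring

lemma graeffe_iterate_smul (d : ℕ) (c : R) (f : ℕ → R) (k : ℕ) :
    (graeffe d)^[k] (c • f) = c ^ 2 ^ k • (graeffe d)^[k] f := by
  induction k with
  | zero => simp
  | succ k ih => rw [Function.iterate_succ_apply', ih, graeffe_smul, Function.iterate_succ_apply',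
      ← pow_mul, pow_succ]

lemma map_graeffeTail (φ : R →+* S) (d : ℕ) (f : ℕ → R) (i m : ℕ) :
    φ (graeffeTail d f i m) = graeffeTail d (φ ∘ f) i m := by
  simp [graeffeTail]

lemma map_graeffe (φ : R →+* S) (d : ℕ) (f : ℕ → R) :
    φ ∘ graeffe d f = graeffe d (φ ∘ f) := by
  ext i
  simp [graeffe, map_graeffeTail, map_ofNat]

lemma map_graeffe_iterate (φ : R →+* S) (d : ℕ) (f : ℕ → R) (k : ℕ) :
    φ ∘ (graeffe d)^[k] f = (graeffe d)^[k] (φ ∘ f) := by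
  induction k with
  | zero => rfl
  | succ k ih => rw [Function.iterate_succ_apply', map_graeffe, ih, Function.iterate_succ_apply']

lemma sum_range_two_mul_add_one (g : ℕ → R) (i : ℕ) :
    ∑ a ∈ range (2 * i + 1), g a =
      g i + ∑ j ∈ range i, (g (i - (j + 1)) + g (i + (j + 1))) := by
  rw [show 2 * i + 1 = i + (i + 1) by ring, sum_range_add, sum_range_succ', sum_add_distrib,
    ← sum_range_reflect]
  have : ∑ j ∈ range i, g (i - 1 - j) = ∑ j ∈ range i, g (i - (j + 1)) :=
    sum_congr rfl fun j _ => by congr 1; omega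
  rw [this]
  simp only [add_zero]
  ring

lemma graeffe_coeff (d : ℕ) (p : R[X]) (hp : p.natDegree ≤ d) (i : ℕ) :
    graeffe d p.coeff i = (-1) ^ d * (p.comp (-X) * p).coeff (2 * i) := by
  have hmul : (p.comp (-X) * p).coeff (2 * i) =
      ∑ a ∈ range (2 * i + 1), (-1) ^ a * (p.coeff a * p.coeff (2 * i - a)) := by
    rw [coeff_mul, Nat.sum_antidiagonal_eq_sum_range_succ
      (fun a b => (p.comp (-X)).coeff a * p.coeff b)]
    refine sum_congr rfl fun a _ => ?_
    have : (p.comp (-X)).coeff a = (-1) ^ a * p.coeff a := by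
      rw [← neg_one_mul, ← C_1, ← C_neg, comp_C_mul_X_coeff, mul_comm]
    rw [this]
    ring
  rw [hmul, sum_range_two_mul_add_one, graeffe, graeffeTail]
  have htail : ∑ j ∈ range i, ((-1 : R) ^ (i - (j + 1)) *
        (p.coeff (i - (j + 1)) * p.coeff (2 * i - (i - (j + 1)))) +
        (-1) ^ (i + (j + 1)) * (p.coeff (i + (j + 1)) * p.coeff (2 * i - (i + (j + 1))))) =
      ∑ j ∈ range (min i (d - i)), ((-1 : R) ^ (i - (j + 1)) *
        (p.coeff (i - (j + 1)) * p.coeff (2 * i - (i - (j + 1)))) +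
        (-1) ^ (i + (j + 1)) * (p.coeff (i + (j + 1)) * p.coeff (2 * i - (i + (j + 1))))) := by
    symm
    refine sum_subset (range_subset_range.2 (min_le_left _ _)) fun j hj hj' => ?_
    simp only [mem_range, not_lt] at hj hj'
    have h0 : p.coeff (i + (j + 1)) = 0 := coeff_eq_zero_of_natDegree_lt (by omega)
    rw [show 2 * i - (i - (j + 1)) = i + (j + 1) by omega, h0]
    ring
  rw [htail, mul_add, show 2 * i - i = i by omega, mul_sum, mul_sum]
  congr 1
  · ring
  refine sum_congr rfl fun j hj => ?_
  simp only [mem_range, lt_min_iff] at hj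
  rw [show 2 * i - (i - (j + 1)) = i + (j + 1) by omega,
    show 2 * i - (i + (j + 1)) = i - (j + 1) by omega,
    show d + i - (j + 1) = d + (i - (j + 1)) by omega,
    show i + (j + 1) = (i - (j + 1)) + 2 * (j + 1) by omega, pow_add (-1 : R) _ (2 * (j + 1)),
    pow_mul]
  ring

lemma graeffe_prod_X_sub_C (c : R) (s : Multiset R) (i : ℕ) :
    graeffe (Multiset.card s) (C c * (s.map fun z => X - C z).prod).coeff i =
      (C (c ^ 2) * (s.map fun z => X - C (z ^ 2)).prod).coeff i := by
  have hdeg : (C c * (s.map fun z => X - C z).prod).natDegree ≤ Multiset.card s := by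
    refine (natDegree_C_mul_le _ _).trans ((natDegree_multiset_prod_le _).trans ?_)
    rw [Multiset.map_map]
    refine (Multiset.sum_le_card_nsmul _ 1 ?_).trans (by simp)
    simp only [Multiset.mem_map, Function.comp]
    rintro _ ⟨z, _, rfl⟩
    exact natDegree_X_sub_C_le z
  rw [graeffe_coeff _ _ hdeg]
  have key : C ((-1) ^ Multiset.card s) * ((C c * (s.map fun z => X - C z).prod).comp (-X) *
      (C c * (s.map fun z => X - C z).prod)) =
      expand R 2 (C (c ^ 2) * (s.map fun z => X - C (z ^ 2)).prod) := by
    have hprod : C ((-1) ^ Multiset.card s) * ((s.map fun z => X - C z).prod.comp (-X) *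
        (s.map fun z => X - C z).prod) =
        expand R 2 (s.map fun z => X - C (z ^ 2)).prod := by
      clear hdeg
      induction s using Multiset.induction with
      | empty => simp
      | cons a s ih =>
        simp only [Multiset.map_cons, Multiset.prod_cons, Multiset.card_cons, mul_comp, sub_comp,
          X_comp, C_comp, _root_.map_mul, map_sub, expand_X, expand_C, pow_succ, map_neg, map_one,
          pow_zero, one_mul] at ih ⊢
        rw [← ih]
        ring
    rw [mul_comp, C_comp, _root_.map_mul, ← hprod, expand_C, C_pow (n := 2)]
    ring
  have := congr_arg (fun p => p.coeff (i * 2)) key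
  simp only [coeff_C_mul, coeff_expand_mul two_pos] at this
  rw [mul_comm 2 i, coeff_C_mul, ← this]

lemma graeffe_iterate_prod_X_sub_C (c : R) (s : Multiset R) (k : ℕ) :
    (graeffe (Multiset.card s))^[k] (C c * (s.map fun z => X - C z).prod).coeff =
      (C (c ^ 2 ^ k) * (s.map fun z => X - C (z ^ 2 ^ k)).prod).coeff := by
  induction k with
  | zero => simp
  | succ k ih =>
    rw [Function.iterate_succ_apply', ih]
    ext i
    have := graeffe_prod_X_sub_C (c ^ 2 ^ k) (s.map fun z => z ^ 2 ^ k) i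
    simpa only [Multiset.card_map, Multiset.map_map, Function.comp_def, ← pow_mul, ← pow_succ]
      using this

end Graeffe

/-! ### Renormalized arithmetic represents exact arithmetic -/

section Renormalized

lemma toComplex_ofComplex (k : ℕ) {w : ℂ} (hw : w ≠ 0) : toComplex k (ofComplex k w) = w := by
  simp only [toComplex, ofComplex]
  rw [mul_inv_cancel_left₀ (by positivity), Real.exp_log (norm_pos_iff.2 hw),
    Real.Angle.toCircle_coe, Circle.coe_exp]
  exact Complex.norm_mul_exp_arg_mul_I w

lemma renorm_ofComplex (k : ℕ) (w : ℂ) : renorm (ofComplex k w) = ofComplex (k + 1) w := by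
  simp only [renorm, ofComplex, pow_succ, mul_inv, Prod.mk.injEq, and_true]
  ring

lemma renMul_ofComplex (k : ℕ) {z w : ℂ} (hz : z ≠ 0) (hw : w ≠ 0) :
    renMul (ofComplex k z) (ofComplex k w) = ofComplex k (z * w) := by
  simp only [renMul, ofComplex, norm_mul, Complex.arg_mul_coe_angle hz hw, Prod.mk.injEq, and_true]
  rw [Real.log_mul (by simpa) (by simpa)]
  ring

lemma renScal_ofComplex (k : ℕ) {z w : ℂ} (hz : z ≠ 0) (hw : w ≠ 0) :
    renScal k z (ofComplex k w) = ofComplex k (z * w) := by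
  rw [mul_comm, ← renMul_ofComplex k hw hz]
  rfl

lemma renPow_two_ofComplex (k : ℕ) {w : ℂ} (hw : w ≠ 0) :
    renPow (ofComplex k w) 2 = ofComplex k (w ^ 2) := by
  rw [pow_two, ← renMul_ofComplex k hw hw]
  simp [renPow, renMul, two_mul, two_nsmul]

lemma renAdd_ofComplex (k : ℕ) {z w : ℂ} (hz : z ≠ 0) (hw : w ≠ 0) :
    renAdd k (ofComplex k z) (ofComplex k w) = ofComplex k (z + w) := by
  rw [renAdd, toComplex_ofComplex k hz, toComplex_ofComplex k hw]

lemma foldl_renAdd_ofComplex (k : ℕ) (l : List ℂ) (t : ℂ) (hl : ∀ z ∈ l, z ≠ 0)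
    (ht : ∀ n, t + (l.take n).sum ≠ 0) :
    (l.map (ofComplex k)).foldl (renAdd k) (ofComplex k t) = ofComplex k (t + l.sum) := by
  induction l generalizing t with
  | nil => simp
  | cons a l ih =>
    have h0 : t ≠ 0 := by simpa using ht 0
    rw [List.map_cons, List.foldl_cons, renAdd_ofComplex k h0 (hl a (by simp)), List.sum_cons,
      ← add_assoc]
    refine ih _ (fun z hz => hl z (by simp [hz])) fun n => ?_
    simpa [add_assoc] using ht (n + 1)

/-- The renormalized evaluation of the Graeffe formula, for given values of the terms. -/
lemma renAdd_foldl_ofComplex (k : ℕ) (w : ℂ) (hw : w ≠ 0) (l : List ℂ) (hl : ∀ z ∈ l, z ≠ 0)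
    (hs : ∀ n, 1 ≤ n → n ≤ l.length → (l.take n).sum ≠ 0) :
    (match l.map (ofComplex k) with
      | [] => ofComplex k w
      | t :: ts => renAdd k (ofComplex k w) (renScal k 2 (ts.foldl (renAdd k) t))) =
      ofComplex k (w + 2 * l.sum) := by
  cases l with
  | nil => simp
  | cons a l =>
    have hpre : ∀ n, a + (l.take n).sum ≠ 0 := fun n => by
      rcases le_total n l.length with h | h
      · simpa using hs (n + 1) (by omega) (by simpa)
      · simpa [List.take_of_length_le h] using hs (l.length + 1) (by omega) (by simp)
    have hsum : a + l.sum ≠ 0 := by simpa using hpre l.length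
    simp only [List.map_cons]
    rw [foldl_renAdd_ofComplex k l a (fun z hz => hl z (by simp [hz])) hpre,
      renScal_ofComplex k two_ne_zero hsum,
      renAdd_ofComplex k hw (mul_ne_zero two_ne_zero hsum), List.sum_cons]

/-- The renormalized Graeffe step meets no zero: neither a coefficient nor an intermediate
sum vanishes. -/
def StepRegular (d : ℕ) (f : ℕ → ℂ) : Prop :=
  ∀ i ≤ d, f i ≠ 0 ∧ ∀ m, 1 ≤ m → m ≤ min i (d - i) → graeffeTail d f i m ≠ 0

lemma renStep_ofComplex {d : ℕ} (k : ℕ) (f : ℕ → ℂ) (hf : StepRegular d f) :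
    renStep k (fun i : Fin (d + 1) => ofComplex k (f i)) =
      fun i : Fin (d + 1) => ofComplex (k + 1) (graeffe d f i) := by
  funext i
  have hne : ∀ j ≤ d, f j ≠ 0 := fun j hj => (hf j hj).1
  have hi : (i : ℕ) ≤ d := Nat.lt_succ_iff.1 i.2
  have hsgn : ∀ j, graeffeSign d i j ≠ 0 := fun j => pow_ne_zero _ (by simp)
  let a : Fin (min (i : ℕ) (d - i)) → ℂ := fun j =>
    (-1) ^ (d + i - (j + 1)) * (f (i - (j + 1)) * f (i + (j + 1)))
  have hterms : (List.ofFn fun j : Fin (min (i : ℕ) (d - i)) =>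
      renScal (k + 1) (graeffeSign d i (j + 1))
        (renMul (renorm (ofComplex k (f (i - (j + 1))))) (renorm (ofComplex k (f (i + (j + 1))))))) =
      (List.ofFn a).map (ofComplex (k + 1)) := by
    rw [List.map_ofFn]
    congr 1
    funext j
    have h1 := hne (i - (j + 1)) (by omega)
    have h2 := hne (i + (j + 1)) (by omega)
    rw [renorm_ofComplex, renorm_ofComplex, renMul_ofComplex _ h1 h2,
      renScal_ofComplex _ (hsgn _) (mul_ne_zero h1 h2)]
    rfl
  have hfirst : renScal (k + 1) (graeffeSign d i 0) (renPow (renorm (ofComplex k (f i))) 2) =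
      ofComplex (k + 1) ((-1) ^ (d + i : ℕ) * f i ^ 2) := by
    rw [renorm_ofComplex, renPow_two_ofComplex _ (hne i hi),
      renScal_ofComplex _ (hsgn _) (pow_ne_zero _ (hne i hi))]
    rfl
  have htake : ∀ n ≤ min (i : ℕ) (d - i), ((List.ofFn a).take n).sum = graeffeTail d f i n := by
    intro n hn
    rw [List.sum_take_ofFn, graeffeTail, Finset.sum_filter, Fin.sum_univ_eq_sum_range
      (fun j => if j < n then (-1 : ℂ) ^ (d + i - (j + 1)) * (f (i - (j + 1)) * f (i + (j + 1)))
        else 0), ← Finset.sum_filter]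
    refine Finset.sum_congr ?_ fun _ _ => rfl
    ext j
    simp only [Finset.mem_filter, Finset.mem_range]
    omega
  have := renAdd_foldl_ofComplex (k + 1) ((-1) ^ (d + i : ℕ) * f i ^ 2)
    (mul_ne_zero (pow_ne_zero _ (by simp)) (pow_ne_zero _ (hne i hi))) (List.ofFn a)
    (by
      simp only [List.mem_ofFn]
      rintro _ ⟨j, rfl⟩
      exact mul_ne_zero (pow_ne_zero _ (by simp))
        (mul_ne_zero (hne _ (by omega)) (hne _ (by omega))))
    (fun n h1 h2 => by
      rw [List.length_ofFn] at h2
      rw [htake n h2]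
      exact (hf i hi).2 n h1 h2)
  simp only [renStep]
  rw [hfirst, hterms]
  refine this.trans ?_
  rw [graeffe, ← htake _ le_rfl, List.take_of_length_le (by simp)]

lemma renGraeffe_eq_ofComplex {d : ℕ} (f : Fin (d + 1) → ℂ) (F : ℕ → ℂ) (hF : ∀ i : Fin (d + 1), F i = f i)
    (hreg : ∀ k, StepRegular d ((graeffe d)^[k] F)) (k : ℕ) :
    renGraeffe f k = fun i : Fin (d + 1) => ofComplex k ((graeffe d)^[k] F i) := by
  induction k with
  | zero => simp [renGraeffe, hF]
  | succ k ih => rw [renGraeffe, ih, renStep_ofComplex k _ (hreg k), Function.iterate_succ_apply']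

end Renormalized

end RenormalizedGraeffe

namespace RenormalizedGraeffe

/-! ### Convergence for separated root moduli -/

section Convergence

open Finset Polynomial

lemma prod_le_mul_prod_of_card_eq {ι : Type*} [DecidableEq ι] (r : ι → ℝ) (hr : ∀ i, 0 ≤ r i)
    {q : ℝ} (hq0 : 0 ≤ q) (hq1 : q ≤ 1) {s t : Finset ι} (hcard : #s = #t) (hst : s ≠ t)
    (hsep : ∀ i ∈ t, ∀ j ∉ t, r j ≤ q * r i) : ∏ i ∈ s, r i ≤ q * ∏ i ∈ t, r i := by
  have hdiff : #(s \ t) = #(t \ s) := card_sdiff_comm hcard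
  have hne : (s \ t).Nonempty := by
    rw [sdiff_nonempty]
    exact fun h => hst (eq_of_subset_of_card_le h hcard.ge)
  obtain ⟨j₀, hj₀, hmax⟩ := exists_max_image (s \ t) r hne
  have hj₀t : j₀ ∉ t := (mem_sdiff.1 hj₀).2
  have hkey : ∏ i ∈ s \ t, r i ≤ q * ∏ i ∈ t \ s, r i := calc
    ∏ i ∈ s \ t, r i ≤ ∏ _i ∈ s \ t, r j₀ := prod_le_prod (fun i _ => hr i) hmax
    _ = ∏ _i ∈ t \ s, r j₀ := by rw [prod_const, prod_const, hdiff]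
    _ ≤ ∏ i ∈ t \ s, q * r i :=
      prod_le_prod (fun i _ => hr j₀) fun i hi => hsep i (mem_sdiff.1 hi).1 j₀ hj₀t
    _ = q ^ #(t \ s) * ∏ i ∈ t \ s, r i := by rw [prod_mul_distrib, prod_const]
    _ ≤ q * ∏ i ∈ t \ s, r i := by
      refine mul_le_mul_of_nonneg_right ?_ (prod_nonneg fun i _ => hr i)
      exact pow_le_of_le_one hq0 hq1 (by rw [← hdiff]; exact (card_pos.2 hne).ne')
  rw [← prod_inter_mul_prod_sdiff s t, ← prod_inter_mul_prod_sdiff t s, inter_comm t s,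
    mul_left_comm]
  exact mul_le_mul_of_nonneg_left hkey (prod_nonneg fun i _ => hr i)

/-- The first `m` indices. -/
def topIndices (d m : ℕ) : Finset (Fin d) := univ.filter fun i => (i : ℕ) < m

/-- If the moduli decrease at least by the factor `q`, then each elementary symmetric function is
close to its dominant term. -/
lemma norm_esymm_sub_le {d : ℕ} (z : Fin d → ℂ) {q : ℝ} (hq0 : 0 ≤ q) (hq1 : q ≤ 1)
    (hz : ∀ i j, i < j → ‖z j‖ ≤ q * ‖z i‖) {m : ℕ} (hm : m ≤ d) :
    ‖(univ.val.map z).esymm m - ∏ i ∈ topIndices d m, z i‖ ≤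
      2 ^ d * q * ∏ i ∈ topIndices d m, ‖z i‖ := by
  set t : Finset (Fin d) := topIndices d m with ht
  have hcard : #t = m := by rw [ht, topIndices, Fin.card_filter_val_lt, min_eq_right hm]
  have hmem : t ∈ powersetCard m (univ : Finset (Fin d)) :=
    mem_powersetCard.2 ⟨subset_univ _, hcard⟩
  rw [esymm_map_val, ← sum_erase_add _ _ hmem, add_sub_cancel_right]
  calc ‖∑ s ∈ (powersetCard m univ).erase t, s.prod z‖
      ≤ ∑ s ∈ (powersetCard m univ).erase t, ‖s.prod z‖ := norm_sum_le _ _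
    _ ≤ ∑ s ∈ (powersetCard m univ).erase t, q * ∏ i ∈ t, ‖z i‖ := by
      refine sum_le_sum fun s hs => ?_
      obtain ⟨hst, hs⟩ := mem_erase.1 hs
      rw [norm_prod]
      refine prod_le_mul_prod_of_card_eq (fun i => ‖z i‖) (fun i => norm_nonneg _) hq0 hq1
        ((mem_powersetCard.1 hs).2.trans hcard.symm) hst fun i hi j hj => hz i j ?_
      simp only [ht, topIndices, mem_filter, mem_univ, true_and] at hi hj
      exact Fin.lt_def.2 (by omega)
    _ = #((powersetCard m univ).erase t) * (q * ∏ i ∈ t, ‖z i‖) := by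
      rw [sum_const, nsmul_eq_mul]
    _ ≤ 2 ^ d * (q * ∏ i ∈ t, ‖z i‖) := by
      refine mul_le_mul_of_nonneg_right ?_
        (mul_nonneg hq0 (prod_nonneg fun i _ => norm_nonneg _))
      have h1 : #((powersetCard m (univ : Finset (Fin d))).erase t) ≤ 2 ^ d := by
        refine (card_le_card (erase_subset _ _)).trans ?_
        rw [card_powersetCard, card_univ, Fintype.card_fin]
        exact Nat.choose_le_two_pow d m
      exact_mod_cast h1
    _ = _ := by ring

lemma abs_log_sub_log_le {x y ε : ℝ} (hy : 0 < y) (hε : ε ≤ 1 / 2) (h : |x - y| ≤ ε * y) :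
    |Real.log x - Real.log y| ≤ 2 * ε := by
  obtain ⟨h1, h2⟩ := abs_le.1 h
  have hx : 0 < x := by nlinarith
  have hε0 : 0 ≤ ε := nonneg_of_mul_nonneg_left ((abs_nonneg _).trans h) hy
  rw [← Real.log_div hx.ne' hy.ne', abs_le]
  have hu := Real.log_le_sub_one_of_pos (div_pos hx hy)
  have hl := Real.one_sub_inv_le_log_of_pos (div_pos hx hy)
  rw [inv_div] at hl
  have h3 : x / y ≤ 1 + ε := by rw [div_le_iff₀ hy]; linarith
  have h4 : y / x ≤ 1 + 2 * ε := by
    rw [div_le_iff₀ hx]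
    nlinarith [mul_nonneg hε0 hy.le]
  constructor <;> linarith

/-- The moduli of the coefficients are the elementary symmetric functions of the roots, scaled. -/
lemma coeff_prod_X_sub_C_pow {d : ℕ} (c : ℂ) (z : Fin d → ℂ) {m : ℕ} (hm : m ≤ d) :
    ‖(C c * ((univ.val.map z).map fun w => X - C w).prod).coeff (d - m)‖ =
      ‖c‖ * ‖(univ.val.map z).esymm m‖ := by
  have hcard : Multiset.card (univ.val.map z) = d := by simp
  rw [coeff_C_mul, Multiset.prod_X_sub_C_coeff _ (by rw [hcard]; omega), hcard,
    show d - (d - m) = m by omega]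
  simp

lemma abs_log_esymm_sub_le {d : ℕ} (z : Fin d → ℂ) (hz0 : ∀ i, z i ≠ 0) {q : ℝ} (hq0 : 0 ≤ q)
    (hq : 2 ^ d * q ≤ 1 / 2) (hz : ∀ i j, i < j → ‖z j‖ ≤ q * ‖z i‖) {m : ℕ} (hm : m ≤ d) :
    |Real.log ‖(univ.val.map z).esymm m‖ - ∑ i ∈ topIndices d m, Real.log ‖z i‖| ≤
      2 * (2 ^ d * q) := by
  have h1 : (1 : ℝ) ≤ 2 ^ d := one_le_pow₀ one_le_two
  have hpos : 0 < ∏ i ∈ topIndices d m, ‖z i‖ := prod_pos fun i _ => norm_pos_iff.2 (hz0 i)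
  rw [← Real.log_prod fun i _ => norm_ne_zero_iff.2 (hz0 i)]
  refine abs_log_sub_log_le hpos hq ?_
  refine le_trans ?_ (norm_esymm_sub_le z hq0 (by nlinarith) hz hm)
  rw [← norm_prod]
  exact abs_norm_sub_norm_le _ _

lemma esymm_ne_zero {d : ℕ} (z : Fin d → ℂ) (hz0 : ∀ i, z i ≠ 0) {q : ℝ} (hq0 : 0 ≤ q)
    (hq : 2 ^ d * q ≤ 1 / 2) (hz : ∀ i j, i < j → ‖z j‖ ≤ q * ‖z i‖) {m : ℕ} (hm : m ≤ d) :
    (univ.val.map z).esymm m ≠ 0 := by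
  intro h0
  have h1 : (1 : ℝ) ≤ 2 ^ d := one_le_pow₀ one_le_two
  have hpos : 0 < ∏ i ∈ topIndices d m, ‖z i‖ := prod_pos fun i _ => norm_pos_iff.2 (hz0 i)
  have := norm_esymm_sub_le z hq0 (by nlinarith) hz hm
  rw [h0, zero_sub, norm_neg, norm_prod] at this
  nlinarith

variable {d : ℕ} {f : Fin (d + 1) → ℂ}

lemma toPoly_coeff (f : Fin (d + 1) → ℂ) (n : ℕ) :
    (toPoly f).coeff n = if h : n < d + 1 then f ⟨n, h⟩ else 0 := by
  simp only [toPoly, finsetSum_coeff, coeff_C_mul, coeff_X_pow, mul_ite, mul_one, mul_zero]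
  split_ifs with h
  · rw [sum_eq_single ⟨n, h⟩ (fun i _ hi => if_neg fun hn => hi (Fin.ext hn.symm))
      (by simp)]
    simp
  · exact sum_eq_zero fun i _ => if_neg fun hn => h (by omega)

/-- No Graeffe iterate has a vanishing coefficient or a vanishing intermediate sum. -/
def Regular (f : Fin (d + 1) → ℂ) : Prop :=
  ∀ k, StepRegular d ((graeffe d)^[k] (toPoly f).coeff)

lemma renGraeffe_fst_eq (hreg : Regular f) {c : ℂ} (hc : c ≠ 0) {ζ : Fin d → ℂ}
    (hf : toPoly f = C c * ((univ.val.map ζ).map fun w => X - C w).prod) (k : ℕ)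
    (he : ∀ m ≤ d, (univ.val.map fun i => ζ i ^ 2 ^ k).esymm m ≠ 0)
    (j : Fin (d + 1)) {m : ℕ} (hm : m ≤ d) (hj : (j : ℕ) = d - m) :
    (renGraeffe f k j).1 = (2 ^ k)⁻¹ * (Real.log (‖c‖ ^ 2 ^ k) +
      Real.log ‖(univ.val.map fun i => ζ i ^ 2 ^ k).esymm m‖) := by
  rw [renGraeffe_eq_ofComplex f (toPoly f).coeff
    (fun i => by rw [toPoly_coeff, dif_pos i.2]) hreg k, hf]
  have hcard : Multiset.card (univ.val.map ζ) = d := by simp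
  have := graeffe_iterate_prod_X_sub_C c (univ.val.map ζ) k
  rw [hcard] at this
  have h2 := coeff_prod_X_sub_C_pow (c ^ 2 ^ k) (fun i => ζ i ^ 2 ^ k) hm
  simp only [Multiset.map_map, Function.comp_def] at this h2 ⊢
  simp only [ofComplex]
  rw [this, hj, h2, norm_pow, Real.log_mul (by simpa using hc) (by simpa using he m hm)]

theorem abs_logModulusApprox_sub_le (hreg : Regular f) {c : ℂ} (hc : c ≠ 0) {ζ : Fin d → ℂ}
    (hf : toPoly f = C c * ((univ.val.map ζ).map fun w => X - C w).prod) (hζ : ∀ i, ζ i ≠ 0)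
    {q : ℝ} (hq0 : 0 ≤ q) (hsep : ∀ i j, i < j → ‖ζ j‖ ≤ q * ‖ζ i‖) (k : ℕ)
    (hk : 2 ^ d * q ^ 2 ^ k ≤ 1 / 2) (i : Fin d) :
    |logModulusApprox f k i - Real.log ‖ζ i‖| ≤ (2 ^ k)⁻¹ * (4 * (2 ^ d * q ^ 2 ^ k)) := by
  set z : Fin d → ℂ := fun i => ζ i ^ 2 ^ k with hzdef
  have hz0 : ∀ i, z i ≠ 0 := fun i => pow_ne_zero _ (hζ i)
  have hz : ∀ i j, i < j → ‖z j‖ ≤ q ^ 2 ^ k * ‖z i‖ := fun i j hij => by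
    simp only [hzdef, norm_pow, ← mul_pow]
    exact pow_le_pow_left₀ (norm_nonneg _) (hsep i j hij) _
  have hqk : 0 ≤ q ^ 2 ^ k := pow_nonneg hq0 _
  have he : ∀ m ≤ d, (univ.val.map z).esymm m ≠ 0 := fun m hm => esymm_ne_zero z hz0 hqk hk hz hm
  have h1 := renGraeffe_fst_eq hreg hc hf k he i.rev.castSucc (m := i + 1) (by omega)
    (by simp [Fin.val_rev])
  have h2 := renGraeffe_fst_eq hreg hc hf k he i.rev.succ (m := i) (by omega)
    (by simp [Fin.val_rev]; omega)
  have e1 := abs_log_esymm_sub_le z hz0 hqk hk hz (m := i + 1) (by omega)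
  have e2 := abs_log_esymm_sub_le z hz0 hqk hk hz (m := i) (by omega)
  have hsum : ∑ j ∈ topIndices d (i + 1), Real.log ‖z j‖ =
      (∑ j ∈ topIndices d i, Real.log ‖z j‖) + 2 ^ k * Real.log ‖ζ i‖ := by
    have : topIndices d (i + 1) = insert i (topIndices d i) := by
      ext j
      simp only [topIndices, mem_filter, mem_univ, true_and, mem_insert, Fin.ext_iff]
      omega
    rw [this, sum_insert (by simp [topIndices]), add_comm]
    simp [hzdef]
  rw [hsum] at e1
  rw [logModulusApprox, h1, h2]
  set A := Real.log ‖(univ.val.map z).esymm (i + 1)‖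
  set B := Real.log ‖(univ.val.map z).esymm i‖
  set L := Real.log ‖ζ i‖
  set s := ∑ j ∈ topIndices d i, Real.log ‖z j‖
  have hN : (0 : ℝ) < 2 ^ k := by positivity
  have : (2 ^ k)⁻¹ * (Real.log (‖c‖ ^ 2 ^ k) + A) - (2 ^ k)⁻¹ * (Real.log (‖c‖ ^ 2 ^ k) + B) - L =
      (2 ^ k)⁻¹ * ((A - (s + 2 ^ k * L)) - (B - s)) := by
    field_simp
    ring
  rw [this, abs_mul, abs_of_pos (inv_pos.2 hN)]
  refine mul_le_mul_of_nonneg_left ((abs_sub _ _).trans ?_) (inv_pos.2 hN).le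
  linarith

lemma exp_neg_le_two_rpow_neg {t s : ℝ} (ht : 0 ≤ t) (hts : s ≤ t) :
    Real.exp (-t) ≤ 2 ^ (-s) := by
  rw [Real.rpow_def_of_pos two_pos]
  refine Real.exp_le_exp.2 ?_
  have h1 : Real.log 2 ≤ 1 := by linarith [Real.log_two_lt_d9]
  have h2 : 0 ≤ Real.log 2 := Real.log_nonneg one_le_two
  nlinarith

/-- The root moduli, in logarithmic scale, are `η`-separated from each other and from `0`. -/
structure Separated (η : ℝ) (ζ : Fin d → ℂ) : Prop where
  ne_zero : ∀ i, ζ i ≠ 0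
  le_abs_log : ∀ i, η ≤ |Real.log ‖ζ i‖|
  le_abs_sub : ∀ i j, i ≠ j → η ≤ |Real.log ‖ζ i‖ - Real.log ‖ζ j‖|

theorem approximatesLogModuli_of_antitone (hreg : Regular f) {c : ℂ} (hc : c ≠ 0) {ζ : Fin d → ℂ}
    (hf : toPoly f = C c * ((univ.val.map ζ).map fun w => X - C w).prod) {η : ℝ} (hη : 0 < η)
    (hsep : Separated η ζ) (hanti : Antitone fun i => ‖ζ i‖) {b : ℝ} (hb : 0 ≤ b) {k : ℕ}
    (hk : b + d + 2 ≤ η * 2 ^ k) : ApproximatesLogModuli f k b := by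
  refine ⟨ζ, ?_, hanti, hsep.ne_zero, fun i => ?_⟩
  · rw [hf, roots_C_mul _ hc, roots_multiset_prod_X_sub_C]
  have hpos : ∀ i, 0 < ‖ζ i‖ := fun i => norm_pos_iff.2 (hsep.ne_zero i)
  have hq : ∀ i j, i < j → ‖ζ j‖ ≤ Real.exp (-η) * ‖ζ i‖ := fun i j hij => by
    have h1 : Real.log ‖ζ j‖ ≤ Real.log ‖ζ i‖ := Real.log_le_log (hpos j) (hanti hij.le)
    have h2 := hsep.le_abs_sub i j hij.ne
    rw [abs_of_nonneg (sub_nonneg.2 h1)] at h2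
    rw [← Real.exp_log (hpos i), ← Real.exp_log (hpos j), ← Real.exp_add]
    exact Real.exp_le_exp.2 (by linarith)
  have hN : (0 : ℝ) < 2 ^ k := by positivity
  have hexp : Real.exp (-η) ^ 2 ^ k = Real.exp (-(η * 2 ^ k)) := by
    rw [← Real.exp_nat_mul]
    congr 1
    push_cast
    ring
  have hle : 2 ^ d * Real.exp (-η) ^ 2 ^ k ≤ 2 ^ (-b) / 4 := by
    have h := exp_neg_le_two_rpow_neg (by positivity) hk
    rw [hexp]
    calc 2 ^ d * Real.exp (-(η * 2 ^ k)) ≤ (2 : ℝ) ^ d * 2 ^ (-(b + d + 2)) := by gcongr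
      _ = 2 ^ (-b) / 4 := by
        rw [show -(b + d + 2) = -b - d - 2 by ring, Real.rpow_sub two_pos, Real.rpow_sub two_pos,
          Real.rpow_natCast, Real.rpow_two]
        field_simp
        norm_num
  have hb1 : (2 : ℝ) ^ (-b) ≤ 1 := Real.rpow_le_one_of_one_le_of_nonpos one_le_two (by linarith)
  have hb0 : (0 : ℝ) < 2 ^ (-b) := by positivity
  have := abs_logModulusApprox_sub_le hreg hc hf hsep.ne_zero (Real.exp_pos _).le hq k
    (by linarith) i
  refine this.trans ?_
  have h3 : (2 ^ k)⁻¹ ≤ η := by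
    rw [inv_le_iff_one_le_mul₀ hN]
    have : (0 : ℝ) ≤ d := by positivity
    linarith
  calc (2 ^ k)⁻¹ * (4 * (2 ^ d * Real.exp (-η) ^ 2 ^ k)) ≤ η * 2 ^ (-b) := by
        refine mul_le_mul h3 (by linarith) (by positivity) hη.le
    _ ≤ 2 ^ (-b) * |Real.log ‖ζ i‖| := by
        rw [mul_comm]
        exact mul_le_mul_of_nonneg_left (hsep.le_abs_log i) hb0.le

theorem approximatesLogModuli_of_separated (hreg : Regular f) {c : ℂ} (hc : c ≠ 0) {ζ : Fin d → ℂ}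
    (hf : toPoly f = C c * ((univ.val.map ζ).map fun w => X - C w).prod) {η : ℝ} (hη : 0 < η)
    (hsep : Separated η ζ) {b : ℝ} (hb : 0 ≤ b) {k : ℕ}
    (hk : b + d + 2 ≤ η * 2 ^ k) : ApproximatesLogModuli f k b := by
  set σ : Equiv.Perm (Fin d) := Tuple.sort fun i => -‖ζ i‖ with hσ
  have hmap : univ.val.map (ζ ∘ σ) = univ.val.map ζ := by
    rw [← Multiset.map_map, Multiset.map_univ_val_equiv]
  refine approximatesLogModuli_of_antitone hreg hc (ζ := ζ ∘ σ) (by rw [hf, hmap]) hη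
    ⟨fun i => hsep.ne_zero _, fun i => hsep.le_abs_log _,
      fun i j hij => hsep.le_abs_sub _ _ (σ.injective.ne hij)⟩ (fun i j hij => ?_) hb hk
  have := Tuple.monotone_sort (fun i => -‖ζ i‖) hij
  simpa using this

end Convergence

end RenormalizedGraeffe

namespace RenormalizedGraeffe

/-! ### Cancellation to zero is exceptional -/

section Regular

open Finset Polynomial

lemma norm_sum_range_le_two_mul (a : ℕ → ℂ) (m : ℕ)
    (ha : ∀ j, j + 1 < m → ‖a (j + 1)‖ ≤ 1 / 4 * ‖a j‖) :
    ‖∑ j ∈ range m, a j‖ ≤ 2 * ‖a 0‖ := by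
  induction m generalizing a with
  | zero => simp
  | succ m ih =>
    rw [sum_range_succ']
    have h1 := ih (fun j => a (j + 1)) fun j hj => ha (j + 1) (by omega)
    have h2 := norm_add_le (∑ j ∈ range m, a (j + 1)) (a 0)
    rcases Nat.eq_zero_or_pos m with rfl | hm
    · simp
      linarith [norm_nonneg (a 0)]
    · linarith [ha 0 (by omega), norm_nonneg (a 0)]

lemma sum_range_ne_zero_of_decay (a : ℕ → ℂ) {m : ℕ} (hm : 1 ≤ m) (h0 : a 0 ≠ 0)
    (ha : ∀ j, j + 1 < m → ‖a (j + 1)‖ ≤ 1 / 4 * ‖a j‖) : ∑ j ∈ range m, a j ≠ 0 := by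
  obtain ⟨m, rfl⟩ := Nat.exists_eq_add_of_le' hm
  have hpos := norm_pos_iff.2 h0
  rw [sum_range_succ']
  intro h
  have h1 := norm_sum_range_le_two_mul (fun j => a (j + 1)) m fun j hj => ha (j + 1) (by omega)
  rw [eq_neg_of_add_eq_zero_left h, norm_neg] at h1
  rcases Nat.eq_zero_or_pos m with rfl | hm
  · simp at h
    exact h0 h
  · linarith [ha 0 (by omega)]

variable {d : ℕ}

lemma topIndices_succ {m : ℕ} (hm : m < d) :
    topIndices d (m + 1) = insert ⟨m, hm⟩ (topIndices d m) := by
  ext j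
  simp only [topIndices, mem_filter, mem_univ, true_and, mem_insert, Fin.ext_iff]
  omega

lemma prod_topIndices_succ (r : Fin d → ℝ) {m : ℕ} (hm : m < d) :
    ∏ i ∈ topIndices d (m + 1), r i = r ⟨m, hm⟩ * ∏ i ∈ topIndices d m, r i := by
  rw [topIndices_succ hm, prod_insert (by simp [topIndices])]

/-- The absolute values of the elementary symmetric functions of strongly separated numbers are
strongly logarithmically concave. -/
lemma norm_esymm_mul_le (z : Fin d → ℂ) (hz0 : ∀ i, z i ≠ 0) {q : ℝ} (hq0 : 0 ≤ q)
    (hq : 2 ^ d * q ≤ 1 / 36) (hz : ∀ i j, i < j → ‖z j‖ ≤ q * ‖z i‖) {m n : ℕ} (hmn : m < n)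
    (hn : n < d) :
    ‖(univ.val.map z).esymm m‖ * ‖(univ.val.map z).esymm (n + 1)‖ ≤
      1 / 4 * (‖(univ.val.map z).esymm (m + 1)‖ * ‖(univ.val.map z).esymm n‖) := by
  have h1 : (1 : ℝ) ≤ 2 ^ d := one_le_pow₀ one_le_two
  have hq1 : q ≤ 1 / 36 := by nlinarith
  have hpos : ∀ k, 0 < ∏ i ∈ topIndices d k, ‖z i‖ :=
    fun k => prod_pos fun i _ => norm_pos_iff.2 (hz0 i)
  have key : ∀ k ≤ d, 1 / 2 * ∏ i ∈ topIndices d k, ‖z i‖ ≤ ‖(univ.val.map z).esymm k‖ ∧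
      ‖(univ.val.map z).esymm k‖ ≤ 3 / 2 * ∏ i ∈ topIndices d k, ‖z i‖ := fun k hk => by
    have h2 := norm_esymm_sub_le z hq0 (by linarith) hz hk
    have h3 := abs_le.1 ((abs_norm_sub_norm_le _ _).trans h2)
    rw [norm_prod] at h3
    constructor <;> nlinarith [hpos k]
  have e1 := prod_topIndices_succ (fun i => ‖z i‖) (hmn.trans hn)
  have e2 := prod_topIndices_succ (fun i => ‖z i‖) hn
  have hr := hz ⟨m, hmn.trans hn⟩ ⟨n, hn⟩ hmn
  have k1 := (key m (by omega)).2
  have k2 := (key (n + 1) (by omega)).2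
  have k3 := (key (m + 1) (by omega)).1
  have k4 := (key n (by omega)).1
  rw [e2] at k2
  rw [e1] at k3
  set P := ∏ i ∈ topIndices d m, ‖z i‖
  set Q := ∏ i ∈ topIndices d n, ‖z i‖
  have hP : 0 < P := hpos m
  have hQ : 0 < Q := hpos n
  have hrm : 0 < ‖z ⟨m, hmn.trans hn⟩‖ := norm_pos_iff.2 (hz0 _)
  set r := ‖z ⟨m, hmn.trans hn⟩‖
  set s := ‖z ⟨n, hn⟩‖
  have hs : s ≤ 1 / 36 * r := hr.trans (mul_le_mul_of_nonneg_right hq1 hrm.le)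
  calc ‖(univ.val.map z).esymm m‖ * ‖(univ.val.map z).esymm (n + 1)‖
      ≤ (3 / 2 * P) * (3 / 2 * (s * Q)) := mul_le_mul k1 k2 (norm_nonneg _) (by positivity)
    _ ≤ (3 / 2 * P) * (3 / 2 * (1 / 36 * r * Q)) := by gcongr
    _ = 1 / 4 * ((1 / 2 * (r * P)) * (1 / 2 * Q)) := by ring
    _ ≤ 1 / 4 * (‖(univ.val.map z).esymm (m + 1)‖ * ‖(univ.val.map z).esymm n‖) := by gcongr

lemma stepRegular_of_separated {c : ℂ} (hc : c ≠ 0) (z : Fin d → ℂ) (hz0 : ∀ i, z i ≠ 0) {q : ℝ}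
    (hq0 : 0 ≤ q) (hq : 2 ^ d * q ≤ 1 / 36) (hz : ∀ i j, i < j → ‖z j‖ ≤ q * ‖z i‖) :
    StepRegular d (C c * ((univ.val.map z).map fun w => X - C w).prod).coeff := by
  set p := C c * ((univ.val.map z).map fun w => X - C w).prod with hp
  have hnorm : ∀ i ≤ d, ‖p.coeff i‖ = ‖c‖ * ‖(univ.val.map z).esymm (d - i)‖ := fun i hi => by
    rw [hp, ← coeff_prod_X_sub_C_pow c z (Nat.sub_le d i), show d - (d - i) = i by omega]
  have hne : ∀ i ≤ d, p.coeff i ≠ 0 := fun i hi => by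
    rw [← norm_ne_zero_iff, hnorm i hi]
    exact mul_ne_zero (norm_ne_zero_iff.2 hc)
      (norm_ne_zero_iff.2 (esymm_ne_zero z hz0 hq0 (by linarith) hz (Nat.sub_le d i)))
  refine fun i hi => ⟨hne i hi, fun m hm1 hm2 => sum_range_ne_zero_of_decay _ hm1 ?_ ?_⟩
  · exact mul_ne_zero (pow_ne_zero _ (by simp))
      (mul_ne_zero (hne _ (by omega)) (hne _ (by omega)))
  · intro j hj
    simp only [norm_mul, norm_pow, norm_neg, norm_one, one_pow, one_mul]
    rw [hnorm _ (by omega), hnorm _ (by omega), hnorm _ (by omega), hnorm _ (by omega)]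
    have := norm_esymm_mul_le z hz0 hq0 hq hz (m := d - (i + (j + 1 + 1)))
      (n := d - (i - (j + 1))) (by omega) (by omega)
    rw [show d - (i - (j + 1)) + 1 = d - (i - (j + 1 + 1)) by omega,
      show d - (i + (j + 1 + 1)) + 1 = d - (i + (j + 1)) by omega] at this
    have hc2 : 0 ≤ ‖c‖ * ‖c‖ := by positivity
    nlinarith [mul_le_mul_of_nonneg_left this hc2]

lemma toPoly_eq_of_natDegree_le {p : ℂ[X]} (hp : p.natDegree ≤ d) :
    toPoly (fun i : Fin (d + 1) => p.coeff i) = p := by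
  ext n
  rw [toPoly_coeff]
  split_ifs with h
  · rfl
  · exact (coeff_eq_zero_of_natDegree_lt (by omega)).symm

lemma exists_regular (d : ℕ) : ∃ f : Fin (d + 1) → ℂ, Regular f := by
  set q : ℝ := 1 / (36 * 2 ^ d) with hq
  have hq0 : 0 < q := by positivity
  have hq2 : 2 ^ d * q = 1 / 36 := by rw [hq]; field_simp
  have hq1 : q ≤ 1 := by
    have : (1 : ℝ) ≤ 2 ^ d := one_le_pow₀ one_le_two
    nlinarith
  set ζ : Fin d → ℂ := fun i => (q : ℂ) ^ (i : ℕ) with hζ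
  have hζ0 : ∀ i, ζ i ≠ 0 := fun i => pow_ne_zero _ (by exact_mod_cast hq0.ne')
  have hcard : Multiset.card (univ.val.map ζ) = d := by simp
  set p : ℂ[X] := C 1 * ((univ.val.map ζ).map fun w => X - C w).prod with hp
  have hdeg : p.natDegree ≤ d := by
    rw [hp, C_1, one_mul, natDegree_multiset_prod_X_sub_C_eq_card, hcard]
  refine ⟨fun i => p.coeff i, fun k => ?_⟩
  have h := graeffe_iterate_prod_X_sub_C 1 (univ.val.map ζ) k
  rw [hcard] at h
  rw [toPoly_eq_of_natDegree_le hdeg, hp, h]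
  have := stepRegular_of_separated (one_ne_zero : (1 : ℂ) ≠ 0) (fun i => ζ i ^ 2 ^ k)
    (fun i => pow_ne_zero _ (hζ0 i)) hq0.le hq2.le fun i j hij => by
      have hnq : ‖(q : ℂ)‖ = q := by simp [abs_of_pos hq0]
      simp only [hζ, norm_pow, hnq]
      rw [← pow_mul, ← pow_mul, ← pow_succ']
      refine pow_le_pow_of_le_one hq0.le hq1 ?_
      have h1 : (i : ℕ) + 1 ≤ j := hij
      have h2 : 1 ≤ 2 ^ k := Nat.one_le_two_pow
      nlinarith
  simpa [Multiset.map_map, Function.comp_def] using this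

lemma continuous_toPoly_coeff (d : ℕ) :
    Continuous fun f : Fin (d + 1) → ℂ => (toPoly f).coeff := by
  refine continuous_pi fun n => ?_
  simp only [toPoly_coeff]
  split_ifs <;> fun_prop

/-- A homogeneous polynomial function on sequences, given along with its action on sequences of
polynomials in one variable, has a null zero set if it is not zero at some polynomial. -/
lemma volume_zeros_eq_zero (Φ : (ℕ → ℂ) → ℂ) (Ψ : (ℕ → ℂ[X]) → ℂ[X])
    (hΨ : ∀ s Y, (Ψ Y).eval s = Φ fun n => (Y n).eval s) (hΦ : Continuous Φ)
    (hhom : ∀ c : ℂ, c ≠ 0 → ∀ F, Φ (c • F) = 0 → Φ F = 0) (f₀ : Fin (d + 1) → ℂ)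
    (h0 : Φ (toPoly f₀).coeff ≠ 0) :
    volume {f : Fin (d + 1) → ℂ | Φ (toPoly f).coeff = 0} = 0 := by
  have hcont : Continuous fun f : Fin (d + 1) → ℂ => Φ (toPoly f).coeff :=
    hΦ.comp (continuous_toPoly_coeff d)
  have hmeas : MeasurableSet {f : Fin (d + 1) → ℂ | Φ (toPoly f).coeff ≠ 0} :=
    (isOpen_ne.preimage hcont).measurableSet
  have := ae_mem_of_ae_add_linearMap_mem
    ((LinearMap.toSpanSingleton ℂ (Fin (d + 1) → ℂ) f₀).restrictScalars ℝ) volume volume hmeas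
    fun y => ?_
  · simpa [ae_iff] using this
  set Q : ℂ[X] := Ψ fun n => X * C ((toPoly y).coeff n) + C ((toPoly f₀).coeff n) with hQ
  have hQ0 : Q ≠ 0 := fun h => h0 (by
    have := hΨ 0 fun n => X * C ((toPoly y).coeff n) + C ((toPoly f₀).coeff n)
    rw [← hQ, h] at this
    simpa using this.symm)
  have hfin : ({0} ∪ (fun s : ℂ => s⁻¹) '' {s | Q.IsRoot s}).Finite :=
    (Set.finite_singleton 0).union ((finite_setOfPred_isRoot hQ0).image _)
  refine measure_mono_null (fun t ht => ?_) (hfin.measure_zero volume)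
  by_cases ht0 : t = 0
  · exact Or.inl ht0
  refine Or.inr ⟨t⁻¹, ?_, inv_inv t⟩
  simp only [Set.mem_compl_iff, Set.mem_ofPred_eq, not_not] at ht
  have hlin : (toPoly (y + t • f₀)).coeff =
      t • fun n => (X * C ((toPoly y).coeff n) + C ((toPoly f₀).coeff n)).eval t⁻¹ := by
    ext n
    simp only [toPoly_coeff, Pi.smul_apply, eval_add, eval_mul, eval_X, eval_C, smul_eq_mul]
    split_ifs
    · simp only [Pi.add_apply, Pi.smul_apply, smul_eq_mul]
      field_simp
    · simp
  have h1 : Φ (toPoly (y + t • f₀)).coeff = 0 := by simpa using ht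
  rw [hlin] at h1
  simp only [Set.mem_ofPred_eq, IsRoot]
  rw [hQ, hΨ]
  exact hhom t ht0 _ h1

lemma continuous_graeffeTail (d i m : ℕ) : Continuous fun F : ℕ → ℂ => graeffeTail d F i m := by
  unfold graeffeTail
  fun_prop

lemma continuous_graeffe (d : ℕ) : Continuous (graeffe d : (ℕ → ℂ) → ℕ → ℂ) := by
  refine continuous_pi fun i => ?_
  unfold graeffe
  have := continuous_graeffeTail d i (min i (d - i))
  fun_prop

lemma eval_graeffe_iterate (d k : ℕ) (s : ℂ) (Y : ℕ → ℂ[X]) :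
    (fun n => ((graeffe d)^[k] Y n).eval s) = (graeffe d)^[k] fun n => (Y n).eval s :=
  map_graeffe_iterate (evalRingHom s) d Y k

lemma regular_smul_iff {c : ℂ} (hc : c ≠ 0) (f : Fin (d + 1) → ℂ) :
    Regular (c • f) ↔ Regular f := by
  have : (toPoly (c • f)).coeff = c • (toPoly f).coeff := by
    ext n
    simp only [toPoly_coeff, Pi.smul_apply, smul_eq_mul]
    split_ifs <;> simp
  simp only [Regular, StepRegular, this, graeffe_iterate_smul, graeffeTail_smul]
  simp [hc]

lemma setOf_not_regular_eq (d : ℕ) : {f : Fin (d + 1) → ℂ | ¬ Regular f} =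
    ⋃ k : ℕ, ⋃ i ∈ Set.Iic d, {f | (graeffe d)^[k] (toPoly f).coeff i = 0} ∪
      ⋃ m ∈ {m | 1 ≤ m ∧ m ≤ min i (d - i)},
        {f | graeffeTail d ((graeffe d)^[k] (toPoly f).coeff) i m = 0} := by
  ext f
  simp only [Regular, StepRegular, Set.mem_ofPred_eq, Set.mem_iUnion, Set.mem_union, Set.mem_Iic]
  push Not
  simp only [exists_prop]
  refine exists_congr fun k => exists_congr fun i => and_congr_right fun _ => ?_
  simp only [and_assoc, or_iff_not_imp_left, ne_eq]

lemma measurableSet_not_regular (d : ℕ) :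
    MeasurableSet {f : Fin (d + 1) → ℂ | ¬ Regular f} := by
  have hcont (k : ℕ) : Continuous fun f : Fin (d + 1) → ℂ => (graeffe d)^[k] (toPoly f).coeff :=
    ((continuous_graeffe d).iterate k).comp (continuous_toPoly_coeff d)
  rw [setOf_not_regular_eq]
  refine MeasurableSet.iUnion fun k => MeasurableSet.biUnion (Set.to_countable _) fun i _ =>
    MeasurableSet.union ?_ (MeasurableSet.biUnion (Set.to_countable _) fun m _ => ?_)
  · exact (isClosed_eq ((continuous_apply i).comp (hcont k)) continuous_const).measurableSet
  · exact (isClosed_eq ((continuous_graeffeTail d i m).comp (hcont k))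
      continuous_const).measurableSet

lemma volume_not_regular (d : ℕ) : volume {f : Fin (d + 1) → ℂ | ¬ Regular f} = 0 := by
  obtain ⟨f₀, hf₀⟩ := exists_regular d
  rw [setOf_not_regular_eq]
  refine measure_iUnion_null fun k => (measure_biUnion_null_iff (Set.to_countable _)).2
    fun i hi => measure_union_null ?_ ((measure_biUnion_null_iff (Set.to_countable _)).2
      fun m hm => ?_)
  · refine volume_zeros_eq_zero (fun F => (graeffe d)^[k] F i) (fun Y => (graeffe d)^[k] Y i)
      (fun s Y => congr_fun (eval_graeffe_iterate d k s Y) i)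
      ((continuous_apply i).comp ((continuous_graeffe d).iterate k)) (fun c hc F h => ?_) f₀
      (hf₀ k i hi).1
    simpa [graeffe_iterate_smul, hc] using h
  · refine volume_zeros_eq_zero (fun F => graeffeTail d ((graeffe d)^[k] F) i m)
      (fun Y => graeffeTail d ((graeffe d)^[k] Y) i m)
      (fun s Y => ?_)
      ((continuous_graeffeTail d i m).comp ((continuous_graeffe d).iterate k))
      (fun c hc F h => ?_) f₀ ((hf₀ k i hi).2 m hm.1 hm.2)
    · rw [← eval_graeffe_iterate]
      exact map_graeffeTail (evalRingHom s) d _ i m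
    · simpa [graeffe_iterate_smul, graeffeTail_smul, hc] using h

end Regular

end RenormalizedGraeffe

namespace RenormalizedGraeffe

/-! ### Probabilities of cones -/

section Cones

lemma pi_mono_smul {ι : Type*} [Fintype ι] {α : ι → Type*} [∀ i, MeasurableSpace (α i)]
    {μ ν : ∀ i, Measure (α i)} [∀ i, SigmaFinite (μ i)] [∀ i, SigmaFinite (ν i)] (c : ι → ℝ≥0)
    (h : ∀ i, μ i ≤ c i • ν i) : Measure.pi μ ≤ (∏ i, c i) • Measure.pi ν := by
  have h1 : (∏ i, c i) • Measure.pi ν = Measure.pi fun i => c i • ν i := by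
    refine (Measure.pi_eq fun s _ => ?_).symm
    rw [Measure.smul_apply, Measure.pi_pi, ENNReal.smul_def, smul_eq_mul, ENNReal.ofNNReal_finsetProd,
      ← Finset.prod_mul_distrib]
    rfl
  rw [h1]
  have h2 : (Measure.pi μ).toOuterMeasure ≤
      OuterMeasure.pi fun i => (c i • ν i).toOuterMeasure := by
    refine OuterMeasure.le_pi.2 fun s _ => ?_
    change Measure.pi μ _ ≤ _
    rw [Measure.pi_pi]
    exact Finset.prod_le_prod' fun i _ => h i (s i)
  refine Measure.le_iff.2 fun s hs => ?_
  rw [Measure.pi, Measure.pi, toMeasure_apply _ _ hs, toMeasure_apply _ _ hs]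
  have h3 := h2 s
  change Measure.pi μ s ≤ _ at h3
  rw [Measure.pi, toMeasure_apply _ _ hs] at h3
  exact h3

lemma gaussianPDFReal_mul_le {w : ℝ≥0} (hw : 1 ≤ w) {a : ℝ} (x y : ℝ) (h : a ≤ x ^ 2 + y ^ 2) :
    gaussianPDFReal 0 (w / 2) x * gaussianPDFReal 0 (w / 2) y ≤ Real.exp (-(a / w)) := by
  have hw' : (1 : ℝ) ≤ w := by exact_mod_cast hw
  have hpi : 1 ≤ Real.pi := by linarith [Real.pi_gt_three]
  have hs : 1 ≤ √(2 * Real.pi * (w / 2)) := by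
    rw [Real.one_le_sqrt]
    nlinarith
  simp only [gaussianPDFReal, NNReal.coe_div, NNReal.coe_ofNat, sub_zero]
  set s := √(2 * Real.pi * (w / 2))
  have hs1 : s⁻¹ ≤ 1 := inv_le_one_of_one_le₀ hs
  have hs0 : 0 ≤ s⁻¹ := by positivity
  calc s⁻¹ * Real.exp (-x ^ 2 / (2 * (w / 2))) * (s⁻¹ * Real.exp (-y ^ 2 / (2 * (w / 2))))
      = (s⁻¹ * s⁻¹) * Real.exp (-((x ^ 2 + y ^ 2) / w)) := by
        rw [show -((x ^ 2 + y ^ 2) / (w : ℝ)) =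
          -x ^ 2 / (2 * (w / 2)) + -y ^ 2 / (2 * (w / 2)) by field_simp; ring, Real.exp_add]
        ring
    _ ≤ 1 * Real.exp (-(a / w)) := by
        gcongr
        exact mul_le_one₀ hs1 hs0 hs1
    _ = _ := one_mul _

instance (w : ℝ≥0) : IsProbabilityMeasure (complexGaussian w) :=
  Measure.isProbabilityMeasure_map Complex.measurableEquivRealProd.symm.measurable.aemeasurable

lemma complexGaussian_restrict_le {w : ℝ≥0} (hw : 1 ≤ w) {a : ℝ} (ha : 0 ≤ a) :
    (complexGaussian w).restrict {z | a ≤ ‖z‖} ≤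
      Real.toNNReal (Real.exp (-(a ^ 2 / w))) • (volume : Measure ℂ) := by
  have hw2 : w / 2 ≠ 0 := by
    have : (0 : ℝ≥0) < w := zero_lt_one.trans_le hw
    positivity
  refine Measure.le_iff.2 fun s hs => ?_
  have hsa : MeasurableSet (s ∩ {z : ℂ | a ≤ ‖z‖}) :=
    hs.inter (measurableSet_le measurable_const measurable_norm)
  have hmap : complexGaussian w = (((volume : Measure ℝ).prod volume).withDensity
      fun z => gaussianPDF 0 (w / 2) z.1 * gaussianPDF 0 (w / 2) z.2).map
        Complex.measurableEquivRealProd.symm := by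
    rw [← prod_withDensity (measurable_gaussianPDF _ _) (measurable_gaussianPDF _ _),
      ← gaussianReal_of_var_ne_zero _ hw2]
    rfl
  have hvol : (volume : Measure ℂ) (s ∩ {z : ℂ | a ≤ ‖z‖}) =
      ((volume : Measure ℝ).prod volume)
        (Complex.measurableEquivRealProd.symm ⁻¹' (s ∩ {z : ℂ | a ≤ ‖z‖})) :=
    (Complex.volume_preserving_equiv_real_prod.symm.measure_preimage
      hsa.nullMeasurableSet).symm
  have hm := Complex.measurableEquivRealProd.symm.measurable hsa
  rw [Measure.restrict_apply hs, hmap,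
    Measure.map_apply Complex.measurableEquivRealProd.symm.measurable hsa,
    withDensity_apply _ hm, Measure.smul_apply]
  calc _ ≤ ∫⁻ _ in Complex.measurableEquivRealProd.symm ⁻¹' (s ∩ {z : ℂ | a ≤ ‖z‖}),
        ENNReal.ofReal (Real.exp (-(a ^ 2 / w))) ∂((volume : Measure ℝ).prod volume) := by
        refine setLIntegral_mono' hm fun p hp => ?_
        rw [gaussianPDF, gaussianPDF, ← ENNReal.ofReal_mul (gaussianPDFReal_nonneg _ _ _)]
        refine ENNReal.ofReal_le_ofReal (gaussianPDFReal_mul_le hw _ _ ?_)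
        have h1 : a ≤ ‖(⟨p.1, p.2⟩ : ℂ)‖ := hp.2
        have h2 := Complex.sq_norm (⟨p.1, p.2⟩ : ℂ)
        rw [Complex.normSq_mk] at h2
        nlinarith
    _ ≤ _ := by
        rw [setLIntegral_const, ← hvol]
        exact mul_le_mul_right (measure_mono Set.inter_subset_left) _

lemma complexGaussian_le_volume {w : ℝ≥0} (hw : 1 ≤ w) :
    complexGaussian w ≤ (1 : ℝ≥0) • (volume : Measure ℂ) := by
  have := complexGaussian_restrict_le hw le_rfl
  simpa using this

variable {d : ℕ}

lemma one_le_choose (i : Fin (d + 1)) : (1 : ℝ≥0) ≤ (d.choose i : ℝ≥0) := by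
  exact_mod_cast Nat.choose_pos (Nat.lt_succ_iff.1 i.2)

lemma kostlan_le_volume (d : ℕ) : kostlan d ≤ volume := by
  have := pi_mono_smul (fun _ : Fin (d + 1) => (1 : ℝ≥0))
    fun i => complexGaussian_le_volume (one_le_choose i)
  simpa [kostlan, volume_pi] using this

instance (d : ℕ) : IsProbabilityMeasure (kostlan d) := by
  unfold kostlan
  infer_instance

lemma kostlan_inter_coord_le (i : Fin (d + 1)) {a : ℝ} (ha : 0 ≤ a)
    {s : Set (Fin (d + 1) → ℂ)} (hs : MeasurableSet s) :
    kostlan d (s ∩ {f | a ≤ ‖f i‖}) ≤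
      ENNReal.ofReal (Real.exp (-(a ^ 2 / 2 ^ d))) * volume s := by
  classical
  let A : Fin (d + 1) → Set ℂ := Function.update (fun _ => Set.univ) i {z | a ≤ ‖z‖}
  let c : Fin (d + 1) → ℝ≥0 := Function.update (fun _ => 1) i
    (Real.toNNReal (Real.exp (-(a ^ 2 / 2 ^ d))))
  have hA : {f : Fin (d + 1) → ℂ | a ≤ ‖f i‖} = Set.univ.pi A := by
    ext f
    simp only [Set.mem_ofPred_eq, Set.mem_univ_pi, A]
    refine ⟨fun h j => ?_, fun h => by simpa using h i⟩
    rcases eq_or_ne j i with rfl | hj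
    · simpa using h
    · simp [hj]
  have hle : ∀ j : Fin (d + 1), (complexGaussian (d.choose j)).restrict (A j) ≤ c j • volume := fun j => by
    rcases eq_or_ne j i with rfl | hj
    · simp only [A, c, Function.update_self]
      refine (complexGaussian_restrict_le (one_le_choose j) ha).trans ?_
      refine Measure.le_iff.2 fun t _ => ?_
      simp only [Measure.smul_apply]
      gcongr ?_ • _
      refine Real.toNNReal_le_toNNReal (Real.exp_le_exp.2 (neg_le_neg ?_))
      have h1 : (1 : ℝ) ≤ ((d.choose j : ℝ≥0) : ℝ) := by exact_mod_cast one_le_choose j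
      have h2 : ((d.choose j : ℝ≥0) : ℝ) ≤ 2 ^ d := by exact_mod_cast Nat.choose_le_two_pow d j
      gcongr
    · simp only [A, c, Function.update_of_ne hj, Measure.restrict_univ]
      exact complexGaussian_le_volume (one_le_choose j)
  have := pi_mono_smul c hle
  rw [← Measure.restrict_pi_pi, ← hA] at this
  have h := this s
  rw [Measure.restrict_apply hs] at h
  refine h.trans (le_of_eq ?_)
  rw [Measure.smul_apply, Finset.prod_update_of_mem (Finset.mem_univ i)]
  simp [ENNReal.smul_def, volume_pi, ENNReal.ofReal]

lemma kostlan_inter_le {a : ℝ} (ha : 0 ≤ a) {s : Set (Fin (d + 1) → ℂ)} (hs : MeasurableSet s) :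
    kostlan d (s ∩ {f | a ≤ ‖f‖}) ≤
      ENNReal.ofReal ((d + 1) * Real.exp (-(a ^ 2 / 2 ^ d))) * volume s := by
  have hsub : s ∩ {f | a ≤ ‖f‖} ⊆ ⋃ i, s ∩ {f | a ≤ ‖f i‖} := by
    rintro f ⟨hf, hfa⟩
    have : ∃ i, a ≤ ‖f i‖ := by
      by_contra! h
      have hfa' : a ≤ ‖f‖ := hfa
      exact hfa'.not_gt ((pi_norm_lt_iff ((norm_nonneg _).trans_lt (h 0))).2 h)
    obtain ⟨i, hi⟩ := this
    exact Set.mem_iUnion.2 ⟨i, hf, hi⟩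
  calc kostlan d (s ∩ {f | a ≤ ‖f‖}) ≤ ∑ i, kostlan d (s ∩ {f | a ≤ ‖f i‖}) :=
        (measure_mono hsub).trans (measure_iUnion_fintype_le _ _)
    _ ≤ ∑ _i : Fin (d + 1), ENNReal.ofReal (Real.exp (-(a ^ 2 / 2 ^ d))) * volume s :=
        Finset.sum_le_sum fun i _ => kostlan_inter_coord_le i ha hs
    _ = _ := by
        rw [Finset.sum_const, Finset.card_univ, Fintype.card_fin, nsmul_eq_mul,
          ENNReal.ofReal_mul (by positivity), mul_assoc]
        congr 1
        rw [← Nat.cast_succ, ENNReal.ofReal_natCast]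

/-- The Kostlan measure of a cone is controlled by the Lebesgue measure of its part in the unit
ball. -/
theorem exists_kostlan_le_volume_inter_closedBall (d : ℕ) :
    ∃ C : ℝ, 0 ≤ C ∧ ∀ s : Set (Fin (d + 1) → ℂ), MeasurableSet s →
      (∀ t : ℝ, 0 < t → ∀ f ∈ s, t • f ∈ s) →
      kostlan d s ≤ ENNReal.ofReal C * volume (s ∩ Metric.closedBall 0 1) := by
  set D := Module.finrank ℝ (Fin (d + 1) → ℂ) with hD
  let u : ℕ → ℝ := fun n => ((d + 1) * Real.exp (-((n : ℝ) ^ 2 / 2 ^ d))) * ((n : ℝ) + 1) ^ D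
  have hu0 : ∀ n, 0 ≤ u n := fun n => by positivity
  have hsum : Summable u := by
    have hr : (0 : ℝ) < 1 / 2 ^ d := by positivity
    have h1 := (summable_nat_add_iff 1).2 (Real.summable_pow_mul_exp_neg_nat_mul D hr)
    refine Summable.of_nonneg_of_le hu0 (fun n => ?_)
      (h1.mul_left ((d + 1) * Real.exp (1 / 2 ^ d)))
    have hn : (n : ℝ) ≤ (n : ℝ) ^ 2 := by exact_mod_cast Nat.le_self_pow two_ne_zero n
    calc u n ≤ ((d + 1) * Real.exp (-((n : ℝ) / 2 ^ d))) * ((n : ℝ) + 1) ^ D := by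
          simp only [u]
          gcongr
      _ = _ := by
          rw [show -((n : ℝ) / 2 ^ d) = 1 / 2 ^ d + -(1 / 2 ^ d) * ((n + 1 : ℕ) : ℝ) by
            push_cast; ring, Real.exp_add]
          push_cast
          ring
  refine ⟨∑' n, u n, tsum_nonneg hu0, fun s hs hcone => ?_⟩
  have hball : ∀ n : ℕ, volume (s ∩ Metric.closedBall 0 ((n : ℝ) + 1)) ≤
      ENNReal.ofReal (((n : ℝ) + 1) ^ D) * volume (s ∩ Metric.closedBall 0 1) := fun n => by
    have hn : (0 : ℝ) < (n : ℝ) + 1 := by positivity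
    rw [← Measure.addHaar_smul_of_nonneg _ hn.le]
    refine measure_mono fun f hf => ?_
    rw [Set.mem_smul_set_iff_inv_smul_mem₀ hn.ne']
    refine ⟨hcone _ (inv_pos.2 hn) f hf.1, ?_⟩
    have := hf.2
    rw [mem_closedBall_zero_iff] at this ⊢
    rw [norm_smul, Real.norm_of_nonneg (inv_nonneg.2 hn.le), inv_mul_le_iff₀ hn, mul_one]
    exact this
  have hsub : s ⊆ ⋃ n : ℕ, (s ∩ Metric.closedBall 0 ((n : ℝ) + 1)) ∩ {f | (n : ℝ) ≤ ‖f‖} := by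
    intro f hf
    refine Set.mem_iUnion.2 ⟨⌊‖f‖⌋₊, ⟨hf, ?_⟩, Nat.floor_le (norm_nonneg f)⟩
    rw [mem_closedBall_zero_iff]
    exact (Nat.lt_floor_add_one _).le
  calc kostlan d s
      ≤ ∑' n : ℕ, kostlan d ((s ∩ Metric.closedBall 0 ((n : ℝ) + 1)) ∩ {f | (n : ℝ) ≤ ‖f‖}) :=
        (measure_mono hsub).trans (measure_iUnion_le _)
    _ ≤ ∑' n : ℕ, ENNReal.ofReal (u n) * volume (s ∩ Metric.closedBall 0 1) := by
        refine ENNReal.tsum_le_tsum fun n => ?_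
        refine (kostlan_inter_le (Nat.cast_nonneg n)
          (hs.inter Metric.isClosed_closedBall.measurableSet)).trans ?_
        refine (mul_le_mul_right (hball n) _).trans (le_of_eq ?_)
        rw [← mul_assoc, ← ENNReal.ofReal_mul (by positivity)]
    _ = _ := by rw [ENNReal.tsum_mul_right, ENNReal.ofReal_tsum_of_nonneg hu0 hsum]

lemma measurable_mk' (d : ℕ) :
    Measurable (Projectivization.mk' ℂ : {v : Fin (d + 1) → ℂ // v ≠ 0} → ProjPoly d) :=
  fun _ hs => hs

lemma measurableEmbedding_val_ne_zero (d : ℕ) :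
    MeasurableEmbedding (Subtype.val : {v : Fin (d + 1) → ℂ // v ≠ 0} → Fin (d + 1) → ℂ) :=
  MeasurableEmbedding.subtype_coe (measurableSet_singleton (0 : Fin (d + 1) → ℂ)).compl

instance (μ : Measure (Fin (d + 1) → ℂ)) [IsFiniteMeasure μ] : IsFiniteMeasure (projLaw μ) := by
  have : IsFiniteMeasure (μ.comap
      (Subtype.val : {v : Fin (d + 1) → ℂ // v ≠ 0} → Fin (d + 1) → ℂ)) := by
    constructor
    rw [(measurableEmbedding_val_ne_zero d).comap_apply]
    exact measure_lt_top _ _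
  unfold projLaw
  infer_instance

lemma exists_projLaw_eq_of_cone {s : Set (Fin (d + 1) → ℂ)}
    (hs : MeasurableSet s) (hcone : ∀ c : ℂ, c ≠ 0 → ∀ f ∈ s, c • f ∈ s) :
    ∃ t : Set (ProjPoly d), MeasurableSet t ∧
      ∀ μ : Measure (Fin (d + 1) → ℂ), projLaw μ t = μ (s \ {0}) := by
  set t : Set (ProjPoly d) := Projectivization.mk' ℂ '' {v | (v : Fin (d + 1) → ℂ) ∈ s} with ht
  have hpre : Projectivization.mk' ℂ ⁻¹' t =
      {v : {v : Fin (d + 1) → ℂ // v ≠ 0} | (v : Fin (d + 1) → ℂ) ∈ s} := by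
    ext v
    constructor
    · rintro ⟨w, hw, hwv⟩
      obtain ⟨a, ha⟩ := (Projectivization.mk_eq_mk_iff ℂ _ _ w.2 v.2).1 hwv
      have : (v : Fin (d + 1) → ℂ) = (a⁻¹ : ℂˣ) • (w : Fin (d + 1) → ℂ) := by
        rw [← ha, inv_smul_smul]
      change (v : Fin (d + 1) → ℂ) ∈ s
      rw [this]
      exact hcone _ (a⁻¹).ne_zero _ hw
    · exact fun hv => ⟨v, hv, rfl⟩
  have htm : MeasurableSet t := by
    change MeasurableSet (Projectivization.mk' ℂ ⁻¹' t)
    rw [hpre]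
    exact measurable_subtype_coe hs
  refine ⟨t, htm, fun μ => ?_⟩
  rw [projLaw, Measure.map_apply (measurable_mk' d) htm, hpre,
    (measurableEmbedding_val_ne_zero d).comap_apply]
  congr 1
  ext f
  simp [and_comm]

lemma exists_le_kostlan_of_hasBoundedDensity (μ : Measure (Fin (d + 1) → ℂ))
    [IsProbabilityMeasure μ] (hμ : HasBoundedDensity μ) :
    ∃ C : ℝ, 0 ≤ C ∧ ∀ s : Set (Fin (d + 1) → ℂ), MeasurableSet s →
      (∀ c : ℂ, c ≠ 0 → ∀ f ∈ s, c • f ∈ s) → μ s ≤ ENNReal.ofReal C * kostlan d s := by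
  obtain ⟨h0, hac, C, hC⟩ := hμ
  refine ⟨C, C.2, fun s hs hcone => ?_⟩
  obtain ⟨t, ht, hts⟩ := exists_projLaw_eq_of_cone hs hcone
  have : IsFiniteMeasure (projVolume d) := inferInstanceAs (IsFiniteMeasure (projLaw (kostlan d)))
  have hle : projLaw μ t ≤ C * projVolume d t := by
    rw [← Measure.setLIntegral_rnDeriv hac, ← setLIntegral_const]
    exact setLIntegral_mono_ae' ht (hC.mono fun p hp _ => hp)
  rw [ENNReal.ofReal_coe_nnreal]
  calc μ s ≤ μ (s \ {0}) + μ {0} := by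
        refine (measure_mono ?_).trans (measure_union_le _ _)
        rw [Set.sdiff_union_self]
        exact Set.subset_union_left
    _ = projLaw μ t := by rw [h0, add_zero, hts]
    _ ≤ C * projVolume d t := hle
    _ ≤ C * kostlan d s := by
        rw [projVolume, hts]
        exact mul_le_mul_right (measure_mono Set.sdiff_subset) _

end Cones

end RenormalizedGraeffe

namespace RenormalizedGraeffe

/-! ### Polynomials parametrized by their roots -/

section RootParametrization

open Finset Polynomial

lemma volume_annulus_le (r : ℝ) {η : ℝ} (hη : 0 ≤ η) :
    volume {z : ℂ | ‖z‖ ≤ 1 ∧ |‖z‖ - r| ≤ η} ≤ ENNReal.ofReal (4 * Real.pi * η) := by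
  rcases Set.eq_empty_or_nonempty {z : ℂ | ‖z‖ ≤ 1 ∧ |‖z‖ - r| ≤ η} with h | ⟨w, hw1, hw⟩
  · simp [h]
  rw [abs_le] at hw
  set s := min 1 (r + η) with hs
  set t := max 0 (r - η) with ht
  have hws : ‖w‖ ≤ s := le_min hw1 (by linarith)
  have hwt : t ≤ ‖w‖ := max_le (norm_nonneg w) (by linarith)
  have ht0 : 0 ≤ t := le_max_left _ _
  have hts : t ≤ s := hwt.trans hws
  have hst : s - t ≤ 2 * η := by linarith [min_le_right 1 (r + η), le_max_right 0 (r - η)]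
  have hsub : {z : ℂ | ‖z‖ ≤ 1 ∧ |‖z‖ - r| ≤ η} ⊆ Metric.closedBall 0 s \ Metric.ball 0 t := by
    rintro z ⟨h1, h2⟩
    rw [abs_le] at h2
    refine ⟨mem_closedBall_zero_iff.2 (le_min h1 (by linarith)), fun hz => ?_⟩
    exact (mem_ball_zero_iff.1 hz).not_ge (max_le (norm_nonneg z) (by linarith))
  refine (measure_mono hsub).trans ?_
  rw [measure_sdiff (Metric.ball_subset_closedBall.trans (Metric.closedBall_subset_closedBall hts))
    Metric.isOpen_ball.measurableSet.nullMeasurableSet measure_ball_lt_top.ne,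
    Complex.volume_closedBall, Complex.volume_ball, ← ENNReal.ofReal_pow (ht0.trans hts),
    ← ENNReal.ofReal_pow ht0]
  have hpi : ((NNReal.pi : ℝ≥0) : ℝ≥0∞) = ENNReal.ofReal Real.pi := by
    rw [← NNReal.coe_real_pi, ENNReal.ofReal_coe_nnreal]
  rw [hpi, ← ENNReal.ofReal_mul (by positivity), ← ENNReal.ofReal_mul (by positivity),
    ← ENNReal.ofReal_sub _ (by positivity)]
  refine ENNReal.ofReal_le_ofReal ?_
  have h1 : s + t ≤ 2 := by linarith [min_le_left 1 (r + η)]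
  have h2 : (s - t) * (s + t) ≤ 2 * η * 2 :=
    mul_le_mul hst h1 (by linarith) (by linarith)
  nlinarith [Real.pi_pos]

lemma volume_le_of_slices {d : ℕ} {E : Set (Fin (d + 1) → ℂ)} (hE : MeasurableSet E) {R : ℝ}
    (hR : 0 ≤ R) (hER : ∀ x ∈ E, ∀ j, ‖x j‖ ≤ R) (p : Fin (d + 1)) {a : ℝ≥0∞}
    (ha : ∀ y : Fin d → ℂ, volume {z : ℂ | p.insertNth (α := fun _ => ℂ) z y ∈ E} ≤ a) :
    volume E ≤ a * volume (Metric.closedBall (0 : Fin d → ℂ) R) := by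
  set e := MeasurableEquiv.piFinSuccAbove (fun _ : Fin (d + 1) => ℂ) p with he
  have hme := (volume_preserving_piFinSuccAbove (fun _ : Fin (d + 1) => ℂ) p).symm
  rw [← hme.measure_preimage hE.nullMeasurableSet]
  have hm := e.symm.measurable hE
  change ((volume : Measure ℂ).prod (volume : Measure (Fin d → ℂ))) (e.symm ⁻¹' E) ≤ _
  rw [Measure.prod_apply_symm hm, ← setLIntegral_const,
    ← lintegral_indicator Metric.isClosed_closedBall.measurableSet]
  refine lintegral_mono fun y => ?_
  by_cases hy : y ∈ Metric.closedBall (0 : Fin d → ℂ) R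
  · rw [Set.indicator_of_mem hy]
    exact ha y
  · rw [Set.indicator_of_notMem hy, nonpos_iff_eq_zero]
    refine measure_mono_null (fun z hz => hy ?_) measure_empty
    rw [mem_closedBall_zero_iff, pi_norm_le_iff_of_nonneg hR]
    intro j
    have hz' : p.insertNth (α := fun _ => ℂ) z y ∈ E := hz
    simpa using hER _ hz' (p.succAbove j)

variable {d : ℕ}

/-- The polynomial with the roots `x (i + 1)` for `i ∈ T` and `1 / x (i + 1)` for `i ∉ T`, scaled
by `x 0`. -/
noncomputable def rootPoly (T : Finset (Fin d)) (x : Fin (d + 1) → ℂ) : ℂ[X] :=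
  C (x 0) * ∏ i : Fin d, if i ∈ T then X - C (x i.succ) else 1 - C (x i.succ) * X

/-- The coefficients of `rootPoly`. -/
noncomputable def rootMap (T : Finset (Fin d)) (x : Fin (d + 1) → ℂ) : Fin (d + 1) → ℂ :=
  fun n => (rootPoly T x).coeff n

lemma contDiff_coeff_mul {E : Type*} [NormedAddCommGroup E] [NormedSpace ℝ E] {p q : E → ℂ[X]}
    (hp : ∀ n, ContDiff ℝ 1 fun x => (p x).coeff n) (hq : ∀ n, ContDiff ℝ 1 fun x => (q x).coeff n)
    (n : ℕ) : ContDiff ℝ 1 fun x => (p x * q x).coeff n := by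
  simp only [coeff_mul]
  exact ContDiff.sum fun a _ => (hp _).mul (hq _)

lemma contDiff_coeff_C {E : Type*} [NormedAddCommGroup E] [NormedSpace ℝ E] {g : E → ℂ}
    (hg : ContDiff ℝ 1 g) (n : ℕ) : ContDiff ℝ 1 fun x => (C (g x)).coeff n := by
  simp only [coeff_C]
  split_ifs
  exacts [hg, contDiff_const]

lemma contDiff_rootMap (T : Finset (Fin d)) : ContDiff ℝ 1 (rootMap T) := by
  have happly : ∀ j, ContDiff ℝ 1 fun x : Fin (d + 1) → ℂ => x j := fun j => contDiff_apply ℝ ℂ j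
  have hfac : ∀ (i : Fin d) n, ContDiff ℝ 1 fun x : Fin (d + 1) → ℂ =>
      (if i ∈ T then X - C (x i.succ) else 1 - C (x i.succ) * X).coeff n := fun i n => by
    split_ifs
    · simp only [coeff_sub]
      exact contDiff_const.sub (contDiff_coeff_C (happly _) n)
    · simp only [coeff_sub]
      exact contDiff_const.sub
        (contDiff_coeff_mul (contDiff_coeff_C (happly _)) (fun _ => contDiff_const) n)
  have hprod : ∀ (s : Finset (Fin d)) n, ContDiff ℝ 1 fun x : Fin (d + 1) → ℂ =>
      (∏ i ∈ s, if i ∈ T then X - C (x i.succ) else 1 - C (x i.succ) * X).coeff n := fun s => by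
    classical
    induction s using Finset.induction_on with
    | empty => exact fun n => by simpa using contDiff_const
    | insert i s hi ih =>
      simp only [prod_insert hi]
      exact contDiff_coeff_mul (hfac i) ih
  exact contDiff_pi.2 fun n => contDiff_coeff_mul (contDiff_coeff_C (happly 0)) (hprod univ) n

lemma natDegree_rootPoly_le (T : Finset (Fin d)) (x : Fin (d + 1) → ℂ) :
    (rootPoly T x).natDegree ≤ d := by
  refine (natDegree_C_mul_le _ _).trans ((natDegree_prod_le _ _).trans ?_)
  refine (sum_le_card_nsmul _ _ 1 fun i _ => ?_).trans (by simp)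
  split_ifs
  · exact natDegree_X_sub_C_le _
  · exact (natDegree_sub_le _ _).trans (by
      simpa using (natDegree_C_mul_le _ _).trans natDegree_X_le)

lemma norm_zero_le_of_norm_rootMap_le (T : Finset (Fin d)) (x : Fin (d + 1) → ℂ)
    (h : ‖rootMap T x‖ ≤ 1) : ‖x 0‖ ≤ d + 1 := by
  have h1 : 1 ≤ (∏ i : Fin d,
      if i ∈ T then X - C (x i.succ) else 1 - C (x i.succ) * X).mahlerMeasure := by
    refine Finset.prod_induction _ (fun p : ℂ[X] => 1 ≤ p.mahlerMeasure) (fun p q hp hq => ?_)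
      (by simp) fun i _ => ?_
    · rw [mahlerMeasure_mul]
      exact one_le_mul_of_one_le_of_one_le hp hq
    · split_ifs
      · rw [mahlerMeasure_X_sub_C]
        exact le_max_left _ _
      · rcases eq_or_ne (x i.succ) 0 with h0 | h0
        · simp [h0]
        · rw [show 1 - C (x i.succ) * X = C (-x i.succ) * X + C 1 by simp; ring,
            mahlerMeasure_C_mul_X_add_C (neg_ne_zero.2 h0)]
          simp
  calc ‖x 0‖ ≤ (rootPoly T x).mahlerMeasure := by
        rw [rootPoly, mahlerMeasure_mul, mahlerMeasure_const]
        exact le_mul_of_one_le_right (norm_nonneg _) h1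
    _ ≤ (rootPoly T x).sum fun _ a => ‖a‖ := mahlerMeasure_le_sum_norm_coeff _
    _ = ∑ n ∈ range (d + 1), ‖(rootPoly T x).coeff n‖ :=
        sum_over_range' _ (by simp) _ (Nat.lt_succ_of_le (natDegree_rootPoly_le T x))
    _ ≤ ∑ _n ∈ range (d + 1), (1 : ℝ) := by
        refine sum_le_sum fun n hn => ?_
        exact (norm_le_pi_norm (rootMap T x) ⟨n, mem_range.1 hn⟩).trans h
    _ = d + 1 := by simp

/-- Parameters in the closed unit disc with either one modulus `η`-close to `1` or two moduli
`η`-close to each other. -/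
def closeParams (d : ℕ) (η : ℝ) : Set (Fin (d + 1) → ℂ) :=
  {x | (∀ i : Fin d, ‖x i.succ‖ ≤ 1) ∧ ((∃ i : Fin d, |‖x i.succ‖ - 1| ≤ η) ∨
    ∃ i j : Fin d, i ≠ j ∧ |‖x i.succ‖ - ‖x j.succ‖| ≤ η)}

lemma isClosed_closeParams (d : ℕ) (η : ℝ) : IsClosed (closeParams d η) := by
  have h1 : IsClosed {x : Fin (d + 1) → ℂ | ∀ i : Fin d, ‖x i.succ‖ ≤ 1} := by
    simp only [Set.ofPred_forall]
    exact isClosed_iInter fun i => isClosed_le (by fun_prop) (by fun_prop)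
  have h2 : IsClosed {x : Fin (d + 1) → ℂ | ∃ i : Fin d, |‖x i.succ‖ - 1| ≤ η} := by
    simp only [Set.ofPred_exists]
    exact isClosed_iUnion_of_finite fun i => isClosed_le (by fun_prop) (by fun_prop)
  have h3 : IsClosed {x : Fin (d + 1) → ℂ |
      ∃ i j : Fin d, i ≠ j ∧ |‖x i.succ‖ - ‖x j.succ‖| ≤ η} := by
    simp only [Set.ofPred_exists, Set.ofPred_and]
    exact isClosed_iUnion_of_finite fun i => isClosed_iUnion_of_finite fun j =>
      isClosed_const.inter (isClosed_le (by fun_prop) (by fun_prop))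
  exact h1.inter (h2.union h3)

lemma isCompact_closeParams_inter (d : ℕ) (η M : ℝ) :
    IsCompact (closeParams d η ∩ {x | ‖x 0‖ ≤ M}) := by
  refine Metric.isCompact_of_isClosed_isBounded
    ((isClosed_closeParams d η).inter (isClosed_le (by fun_prop) (by fun_prop)))
    (Metric.isBounded_closedBall (x := (0 : Fin (d + 1) → ℂ)) (r := max M 1) |>.subset ?_)
  rintro x ⟨hx, hx0⟩
  rw [mem_closedBall_zero_iff, pi_norm_le_iff_of_nonneg (zero_le_one.trans (le_max_right _ _))]
  exact Fin.cases (le_max_of_le_left hx0) fun i => le_max_of_le_right (hx.1 i)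

lemma volume_closeParams_inter_le (d : ℕ) {η M : ℝ} (hη : 0 ≤ η) (hM : 1 ≤ M) :
    volume (closeParams d η ∩ {x | ‖x 0‖ ≤ M}) ≤
      ENNReal.ofReal ((d + d ^ 2) * (4 * Real.pi * η)) *
        volume (Metric.closedBall (0 : Fin d → ℂ) M) := by
  set K : Set (Fin (d + 1) → ℂ) := {x | ‖x 0‖ ≤ M ∧ ∀ i : Fin d, ‖x i.succ‖ ≤ 1} with hK
  have hKm : IsClosed K := by
    simp only [hK, Set.ofPred_and, Set.ofPred_forall]
    exact (isClosed_le (by fun_prop) (by fun_prop)).inter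
      (isClosed_iInter fun i => isClosed_le (by fun_prop) (by fun_prop))
  have hKR : ∀ x ∈ K, ∀ j, ‖x j‖ ≤ M := fun x hx =>
    Fin.cases hx.1 fun i => (hx.2 i).trans hM
  set V := volume (Metric.closedBall (0 : Fin d → ℂ) M) with hV
  set A := ENNReal.ofReal (4 * Real.pi * η) with hA
  have h1 : ∀ i : Fin d, volume (K ∩ {x | |‖x i.succ‖ - 1| ≤ η}) ≤ A * V := fun i => by
    have hcl : IsClosed {x : Fin (d + 1) → ℂ | |‖x i.succ‖ - 1| ≤ η} :=
      isClosed_le (by fun_prop) (by fun_prop)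
    refine volume_le_of_slices (hKm.inter hcl).measurableSet
      (zero_le_one.trans hM) (fun x hx => hKR x hx.1) i.succ fun y => ?_
    refine le_trans (measure_mono fun z hz => ?_) (volume_annulus_le 1 hη)
    have h1 := hz.1.2 i
    have h2 := hz.2
    simp only [Set.mem_ofPred_eq, Fin.insertNth_apply_same] at h1 h2 ⊢
    exact ⟨h1, h2⟩
  have h2 : ∀ p : Fin d × Fin d, volume (K ∩ {x | p.1 ≠ p.2 ∧
      |‖x p.1.succ‖ - ‖x p.2.succ‖| ≤ η}) ≤ A * V := fun ⟨i, j⟩ => by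
    rcases eq_or_ne i j with rfl | hij
    · simp
    have hcl : IsClosed {x : Fin (d + 1) → ℂ | |‖x i.succ‖ - ‖x j.succ‖| ≤ η} :=
      isClosed_le (by fun_prop) (by fun_prop)
    refine volume_le_of_slices (hKm.inter (isClosed_const.inter hcl)).measurableSet
      (zero_le_one.trans hM) (fun x hx => hKR x hx.1) i.succ fun y => ?_
    obtain ⟨k, hk⟩ := Fin.exists_succAbove_eq
      (fun h => hij (Fin.succ_injective _ h).symm : j.succ ≠ i.succ)
    refine le_trans (measure_mono fun z hz => ?_) (volume_annulus_le ‖y k‖ hη)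
    have h1 := hz.1.2 i
    have h2 := hz.2.2
    simp only [← hk, Set.mem_ofPred_eq, Fin.insertNth_apply_same, Fin.insertNth_apply_succAbove]
      at h1 h2 ⊢
    exact ⟨h1, h2⟩
  have hsub : closeParams d η ∩ {x | ‖x 0‖ ≤ M} ⊆ (⋃ i : Fin d, K ∩ {x | |‖x i.succ‖ - 1| ≤ η}) ∪
      ⋃ p : Fin d × Fin d, K ∩ {x | p.1 ≠ p.2 ∧ |‖x p.1.succ‖ - ‖x p.2.succ‖| ≤ η} := by
    rintro x ⟨⟨hx1, ⟨i, hi⟩ | ⟨i, j, hij, h⟩⟩, hx0⟩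
    · exact Or.inl (Set.mem_iUnion.2 ⟨i, ⟨hx0, hx1⟩, hi⟩)
    · exact Or.inr (Set.mem_iUnion.2 ⟨(i, j), ⟨hx0, hx1⟩, hij, h⟩)
  calc volume (closeParams d η ∩ {x | ‖x 0‖ ≤ M})
      ≤ ∑ _i : Fin d, A * V + ∑ _p : Fin d × Fin d, A * V := by
        refine (measure_mono hsub).trans ((measure_union_le _ _).trans (add_le_add ?_ ?_))
        · exact (measure_iUnion_fintype_le _ _).trans (sum_le_sum fun i _ => h1 i)
        · exact (measure_iUnion_fintype_le _ _).trans (sum_le_sum fun p _ => h2 p)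
    _ = _ := by
        rw [ENNReal.ofReal_mul (by positivity), sum_const, sum_const, card_univ, card_univ,
          Fintype.card_prod, Fintype.card_fin, nsmul_eq_mul, nsmul_eq_mul, ← add_mul, ← mul_assoc,
          ← pow_two]
        congr 2
        rw [ENNReal.ofReal_add (by positivity) (by positivity), ENNReal.ofReal_natCast,
          ENNReal.ofReal_pow (by positivity), ENNReal.ofReal_natCast]
        push_cast
        rfl

/-- The polynomials with some root modulus close to `1` or to another one. -/
def closeSet (d : ℕ) (η : ℝ) : Set (Fin (d + 1) → ℂ) :=
  ⋃ T : Finset (Fin d), rootMap T '' closeParams d η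

lemma smul_rootMap (T : Finset (Fin d)) (c : ℂ) (x : Fin (d + 1) → ℂ) :
    c • rootMap T x = rootMap T (Function.update x 0 (c * x 0)) := by
  ext n
  simp [rootMap, rootPoly, mul_assoc]

lemma smul_mem_closeSet {η : ℝ} (c : ℂ) {f : Fin (d + 1) → ℂ} (hf : f ∈ closeSet d η) :
    c • f ∈ closeSet d η := by
  obtain ⟨T, x, hx, rfl⟩ := Set.mem_iUnion.1 hf
  exact Set.mem_iUnion.2 ⟨T, _, by simpa [closeParams] using hx, (smul_rootMap T c x).symm⟩

lemma measurableSet_closeSet (d : ℕ) (η : ℝ) : MeasurableSet (closeSet d η) := by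
  refine MeasurableSet.iUnion fun T => ?_
  have : closeParams d η = ⋃ n : ℕ, closeParams d η ∩ {x | ‖x 0‖ ≤ n} := by
    rw [← Set.inter_iUnion, Set.left_eq_inter]
    exact fun x _ => Set.mem_iUnion.2 (exists_nat_ge ‖x 0‖)
  rw [this, Set.image_iUnion]
  exact MeasurableSet.iUnion fun n => ((isCompact_closeParams_inter d η n).image
    (contDiff_rootMap T).continuous).measurableSet

lemma exists_volume_rootMap_image_le (T : Finset (Fin d)) :
    ∃ C : ℝ, 0 ≤ C ∧ ∀ η : ℝ, 0 ≤ η →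
      volume (rootMap T '' closeParams d η ∩ Metric.closedBall 0 1) ≤ ENNReal.ofReal (C * η) := by
  set M : ℝ := d + 1 with hM
  have hM1 : 1 ≤ M := by simp [hM]
  have hcont : Continuous fun x => (fderiv ℝ (rootMap T) x).det :=
    ContinuousLinearMap.continuous_det.comp ((contDiff_rootMap T).continuous_fderiv one_ne_zero)
  obtain ⟨B, hB⟩ := (isCompact_closedBall (0 : Fin (d + 1) → ℂ) M).exists_bound_of_continuousOn
    hcont.continuousOn
  have hB0 : 0 ≤ B := (norm_nonneg _).trans (hB 0 (by simp; linarith))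
  set V := volume (Metric.closedBall (0 : Fin d → ℂ) M) with hV
  have hVtop : V ≠ ∞ := measure_closedBall_lt_top.ne
  refine ⟨B * ((d + d ^ 2) * (4 * Real.pi) * V.toReal), by positivity, fun η hη => ?_⟩
  set E := closeParams d η ∩ {x | ‖x 0‖ ≤ M} with hE
  have hEm : MeasurableSet E := (isCompact_closeParams_inter d η M).measurableSet
  have hsub : rootMap T '' closeParams d η ∩ Metric.closedBall 0 1 ⊆ rootMap T '' E := by
    rintro _ ⟨⟨x, hx, rfl⟩, h1⟩
    exact ⟨x, ⟨hx, norm_zero_le_of_norm_rootMap_le T x (mem_closedBall_zero_iff.1 h1)⟩, rfl⟩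
  calc volume (rootMap T '' closeParams d η ∩ Metric.closedBall 0 1)
      ≤ volume (rootMap T '' E) := measure_mono hsub
    _ ≤ ∫⁻ x in E, ENNReal.ofReal |(fderiv ℝ (rootMap T) x).det| :=
        addHaar_image_le_lintegral_abs_det_fderiv volume hEm fun x _ =>
          ((contDiff_rootMap T).differentiable one_ne_zero x).hasFDerivAt.hasFDerivWithinAt
    _ ≤ ∫⁻ _ in E, ENNReal.ofReal B := by
        refine setLIntegral_mono' hEm fun x hx => ENNReal.ofReal_le_ofReal (hB x ?_)
        rw [mem_closedBall_zero_iff, pi_norm_le_iff_of_nonneg (by linarith)]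
        exact Fin.cases hx.2 fun i => (hx.1.1 i).trans hM1
    _ = ENNReal.ofReal B * volume E := setLIntegral_const _ _
    _ ≤ ENNReal.ofReal B * (ENNReal.ofReal ((d + d ^ 2) * (4 * Real.pi * η)) * V) :=
        mul_le_mul_right (volume_closeParams_inter_le d hη hM1) _
    _ = _ := by
        rw [← ENNReal.ofReal_toReal hVtop, ← ENNReal.ofReal_mul (by positivity),
          ← ENNReal.ofReal_mul hB0, ENNReal.toReal_ofReal ENNReal.toReal_nonneg]
        congr 1
        ring

theorem exists_kostlan_closeSet_le (d : ℕ) :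
    ∃ C : ℝ, 0 ≤ C ∧ ∀ η : ℝ, 0 ≤ η → kostlan d (closeSet d η) ≤ ENNReal.ofReal (C * η) := by
  choose B hB0 hB using fun T : Finset (Fin d) => exists_volume_rootMap_image_le T
  obtain ⟨A, hA0, hA⟩ := exists_kostlan_le_volume_inter_closedBall d
  refine ⟨A * ∑ T, B T, mul_nonneg hA0 (sum_nonneg fun T _ => hB0 T), fun η hη => ?_⟩
  calc kostlan d (closeSet d η)
      ≤ ENNReal.ofReal A * volume (closeSet d η ∩ Metric.closedBall 0 1) :=
        hA _ (measurableSet_closeSet d η) fun t _ f hf => by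
          simpa using smul_mem_closeSet (t : ℂ) hf
    _ ≤ ENNReal.ofReal A * ∑ T, ENNReal.ofReal (B T * η) := by
        gcongr
        rw [closeSet, Set.iUnion_inter]
        exact (measure_iUnion_fintype_le _ _).trans (sum_le_sum fun T _ => hB T η hη)
    _ = _ := by
        rw [← ENNReal.ofReal_sum_of_nonneg fun T _ => mul_nonneg (hB0 T) hη,
          ← ENNReal.ofReal_mul hA0, ← sum_mul, mul_assoc]

lemma abs_exp_sub_exp_le {u v η : ℝ} (hu : u ≤ 0) (hv : v ≤ 0) (h : |u - v| ≤ η) :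
    |Real.exp u - Real.exp v| ≤ η := by
  wlog huv : v ≤ u generalizing u v
  · rw [abs_sub_comm] at h ⊢
    exact this hv hu h (le_of_not_ge huv)
  rw [abs_of_nonneg (sub_nonneg.2 huv)] at h
  rw [abs_of_nonneg (sub_nonneg.2 (Real.exp_le_exp.2 huv))]
  have h1 : Real.exp v = Real.exp u * Real.exp (v - u) := by rw [← Real.exp_add]; congr 1; ring
  have h2 := Real.add_one_le_exp (v - u)
  have h3 : Real.exp u ≤ 1 := Real.exp_le_one_iff.2 hu
  have h4 := Real.exp_pos u
  rw [h1]
  nlinarith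

lemma X_sub_C_eq_mul {ζ : ℂ} (hζ : ζ ≠ 0) : X - C ζ = C (-ζ) * (1 - C ζ⁻¹ * X) := by
  rw [mul_sub, mul_one, ← mul_assoc, ← C_mul, neg_mul, mul_inv_cancel₀ hζ]
  simp
  ring

lemma separated_of_notMem_closeSet {f : Fin (d + 1) → ℂ} {c : ℂ} {ζ : Fin d → ℂ}
    (hf : toPoly f = C c * ((univ.val.map ζ).map fun w => X - C w).prod) (hζ : ∀ i, ζ i ≠ 0)
    {η : ℝ} (hfη : f ∉ closeSet d η) : Separated η ζ := by
  classical
  set T : Finset (Fin d) := univ.filter fun i => ‖ζ i‖ ≤ 1 with hT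
  set z : Fin d → ℂ := fun i => if i ∈ T then ζ i else (ζ i)⁻¹ with hz
  set x : Fin (d + 1) → ℂ := Fin.cons (c * ∏ i, if i ∈ T then 1 else -ζ i) z with hx
  have hpoly : rootPoly T x = toPoly f := by
    rw [hf, rootPoly]
    simp only [hx, Fin.cons_zero, Fin.cons_succ, C_mul, map_prod, mul_assoc, ← prod_mul_distrib]
    rw [Multiset.map_map]
    congr 1
    refine prod_congr rfl fun i _ => ?_
    by_cases hi : i ∈ T
    · simp [hz, hi]
    · simp only [hz, hi, if_false, Function.comp_apply]
      exact (X_sub_C_eq_mul (hζ i)).symm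
  have hfx : rootMap T x = f := by
    ext n
    rw [rootMap, hpoly, toPoly_coeff, dif_pos n.2]
  have hnorm : ∀ i, ‖z i‖ = Real.exp (-|Real.log ‖ζ i‖|) := fun i => by
    have hpos : 0 < ‖ζ i‖ := norm_pos_iff.2 (hζ i)
    by_cases hi : ‖ζ i‖ ≤ 1
    · rw [abs_of_nonpos (Real.log_nonpos hpos.le hi), neg_neg, Real.exp_log hpos]
      simp [hz, hT, hi]
    · rw [abs_of_pos (Real.log_pos (not_le.1 hi)), Real.exp_neg, Real.exp_log hpos]
      simp [hz, hT, hi]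
  have hle : ∀ i, ‖z i‖ ≤ 1 := fun i => by
    rw [hnorm, Real.exp_le_one_iff]
    exact neg_nonpos.2 (abs_nonneg _)
  have hnot : x ∉ closeParams d η := fun h => hfη (Set.mem_iUnion.2 ⟨T, x, h, hfx⟩)
  simp only [closeParams, Set.mem_ofPred_eq, hx, Fin.cons_succ, not_and, not_or, not_exists,
    not_le] at hnot
  obtain ⟨h1, h2⟩ := hnot hle
  refine ⟨hζ, fun i => ?_, fun i j hij => ?_⟩
  · by_contra! h
    refine (h1 i).not_ge ?_
    rw [hnorm, ← Real.exp_zero]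
    refine abs_exp_sub_exp_le (neg_nonpos.2 (abs_nonneg _)) le_rfl ?_
    rw [sub_zero, abs_neg, abs_abs]
    exact h.le
  · by_contra! h
    refine (h2 i j hij).not_ge ?_
    rw [hnorm, hnorm]
    refine abs_exp_sub_exp_le (neg_nonpos.2 (abs_nonneg _)) (neg_nonpos.2 (abs_nonneg _)) ?_
    rw [neg_sub_neg, abs_sub_comm]
    exact (abs_abs_sub_abs_le_abs_sub _ _).trans h.le

lemma exists_roots {f : Fin (d + 1) → ℂ} (hd : f (Fin.last d) ≠ 0) (h0 : f 0 ≠ 0) :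
    ∃ (c : ℂ) (ζ : Fin d → ℂ), c ≠ 0 ∧ (∀ i, ζ i ≠ 0) ∧
      toPoly f = C c * ((univ.val.map ζ).map fun w => X - C w).prod := by
  set p := toPoly f with hp
  have hdeg : p.natDegree = d := by
    refine le_antisymm (natDegree_le_iff_coeff_eq_zero.2 fun n hn => ?_)
      (le_natDegree_of_ne_zero ?_)
    · rw [hp, toPoly_coeff, dif_neg (by omega)]
    · rw [hp, toPoly_coeff, dif_pos d.lt_succ_self]
      exact hd
  have hp0 : p.coeff 0 ≠ 0 := by
    rw [hp, toPoly_coeff, dif_pos d.succ_pos]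
    exact h0
  have hne : p ≠ 0 := fun h => hp0 (by simp [h])
  have hcard : Multiset.card p.roots = d := by
    rw [← hdeg, (IsAlgClosed.splits p).natDegree_eq_card_roots]
  obtain ⟨ζ, hζ⟩ : ∃ ζ : Fin d → ℂ, univ.val.map ζ = p.roots := by
    have key : ∀ (l : List ℂ) (n : ℕ), l.length = n →
        ∃ ζ : Fin n → ℂ, univ.val.map ζ = (l : Multiset ℂ) := by
      rintro l _ rfl
      exact ⟨l.get, by rw [Fin.univ_val_map, List.ofFn_get]⟩
    simpa using key p.roots.toList d (by rw [Multiset.length_toList, hcard])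
  refine ⟨p.leadingCoeff, ζ, leadingCoeff_ne_zero.2 hne, fun i hi => ?_, ?_⟩
  · have hmem : ζ i ∈ p.roots := by
      rw [← hζ]
      exact Multiset.mem_map_of_mem ζ (mem_univ_val i)
    rw [hi] at hmem
    exact hp0 (by rw [coeff_zero_eq_eval_zero]; exact (mem_roots hne).1 hmem)
  · rw [hζ]
    exact (IsAlgClosed.splits p).eq_prod_roots

end RootParametrization

end RenormalizedGraeffe

namespace RenormalizedGraeffe

lemma approximatesLogModuli_of_notMem_closeSet {d : ℕ} {f : Fin (d + 1) → ℂ} (hreg : Regular f)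
    {η : ℝ} (hη : 0 < η) (hf : f ∉ closeSet d η) {b : ℝ} (hb : 0 ≤ b) {k : ℕ}
    (hk : b + d + 2 ≤ η * 2 ^ k) : ApproximatesLogModuli f k b := by
  have hne : ∀ i : Fin (d + 1), f i ≠ 0 := fun i => by
    have := (hreg 0 i (Nat.lt_succ_iff.1 i.2)).1
    rwa [Function.iterate_zero, id, toPoly_coeff, dif_pos i.2] at this
  obtain ⟨c, ζ, hc, hζ, hfζ⟩ := exists_roots (hne (Fin.last d)) (hne 0)
  exact approximatesLogModuli_of_separated hreg hc hfζ hη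
    (separated_of_notMem_closeSet hfζ hζ hf) hb hk

lemma measure_not_regular_eq_zero {d : ℕ} (μ : Measure (Fin (d + 1) → ℂ))
    [IsProbabilityMeasure μ] (hμ : HasBoundedDensity μ) : μ {f | ¬ Regular f} = 0 := by
  obtain ⟨C, _, hC⟩ := exists_le_kostlan_of_hasBoundedDensity μ hμ
  have h := hC _ (measurableSet_not_regular d) fun c hc f hf => (regular_smul_iff hc f).not.2 hf
  have h0 : kostlan d {f | ¬ Regular f} = 0 :=
    le_antisymm ((kostlan_le_volume d _).trans (volume_not_regular d).le) zero_le
  rwa [h0, mul_zero, nonpos_iff_eq_zero] at h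

/-- The number of iterations that is sufficient for separation `δ / A`. -/
lemma le_mul_two_pow_of_logb_le {A b δ : ℝ} (hA : 0 < A) (hb : 1 ≤ b) (hδ : 0 < δ) (d k : ℕ)
    (hk : Real.logb 2 ((d + 3) * A) + 1 * Real.logb 2 b - 1 * Real.logb 2 δ ≤ k) :
    b + d + 2 ≤ δ / A * 2 ^ k := by
  have hd : (0 : ℝ) < d + 3 := by positivity
  have hb0 : 0 < b := by linarith
  rw [one_mul, one_mul, ← Real.logb_mul (by positivity) hb0.ne',
    ← Real.logb_div (by positivity) hδ.ne', Real.logb_le_iff_le_rpow one_lt_two (by positivity),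
    Real.rpow_natCast, div_le_iff₀ hδ] at hk
  rw [div_mul_eq_mul_div, le_div_iff₀ hA]
  have h1 : b + d + 2 ≤ (d + 3) * b := by nlinarith [Nat.cast_nonneg (α := ℝ) d]
  nlinarith

end RenormalizedGraeffe

theorem theorem2 :
    ∃ c₂ c₃ : ℝ, ∀ (d : ℕ), 1 ≤ d → ∀ (μ : Measure (Fin (d + 1) → ℂ)), IsProbabilityMeasure μ →
      RenormalizedGraeffe.HasBoundedDensity μ →
      ∃ c₁ : ℝ, ∀ b δ : ℝ, 1 + Real.logb 2 d ≤ b → 0 < δ →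
        μ {f | ∀ k : ℕ, c₁ + c₂ * Real.logb 2 b - c₃ * Real.logb 2 δ ≤ k →
          RenormalizedGraeffe.ApproximatesLogModuli f k b}ᶜ ≤ ENNReal.ofReal δ := by
  open RenormalizedGraeffe in
  refine ⟨1, 1, fun d hd μ hprob hμ => ?_⟩
  obtain ⟨C, hC0, hC⟩ := exists_le_kostlan_of_hasBoundedDensity μ hμ
  obtain ⟨B, hB0, hB⟩ := exists_kostlan_closeSet_le d
  have hA : 0 < C * B + 1 := by positivity
  refine ⟨Real.logb 2 ((d + 3) * (C * B + 1)), fun b δ hb hδ => ?_⟩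
  have hb1 : 1 ≤ b := by
    have : 0 ≤ Real.logb 2 d := Real.logb_nonneg one_lt_two (by exact_mod_cast hd)
    linarith
  set η := δ / (C * B + 1) with hη
  have hη0 : 0 < η := div_pos hδ hA
  calc _ ≤ μ (closeSet d η ∪ {f | ¬ Regular f}) := by
        refine measure_mono fun f hf => ?_
        by_contra hfn
        simp only [Set.mem_union, not_or, Set.mem_ofPred_eq, not_not] at hfn
        exact hf fun k hk => approximatesLogModuli_of_notMem_closeSet hfn.2 hη0 hfn.1
          (zero_le_one.trans hb1) (le_mul_two_pow_of_logb_le hA hb1 hδ d k hk)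
    _ ≤ μ (closeSet d η) + 0 := by
        rw [← measure_not_regular_eq_zero μ hμ]
        exact measure_union_le _ _
    _ ≤ ENNReal.ofReal C * ENNReal.ofReal (B * η) := by
        rw [add_zero]
        exact (hC _ (measurableSet_closeSet d η) fun c _ f hf => smul_mem_closeSet c hf).trans
          (mul_le_mul_right (hB η hη0.le) _)
    _ ≤ ENNReal.ofReal δ := by
        rw [← ENNReal.ofReal_mul hC0]
        refine ENNReal.ofReal_le_ofReal ?_
        rw [hη, ← mul_assoc, mul_div_assoc', div_le_iff₀ hA]
        nlinarith [mul_nonneg hC0 hB0]
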